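/- **Definitions.** Let $H$ be a complex Hilbert space, with inner product $(\cdot,\cdot)_H$ linear in the first variable. A *degenerate semigroup* on $H$ is a map $S\colon(0,\infty)\to\mathcal L(H)$, $t\mapsto S_t$, which is strongly continuous on $(0,\infty)$, satisfies $S_{t+s}=S_tS_s$ for all $t,s>0$, and satisfies $\sup_{t\in(0,1)}\|S_t\|<\infty$. Let $A\subseteq H\times H$ be a graph (linear relation). The degenerate semigroup $S$ is *generated by* $-A$ if there is an $\omega\in\mathbb R$ such that for all real $\lambda>\omega$ the graph $\lambda I+A=\{(x,\lambda x+y):(x,y)\in A\}$ is boundedly invertible, that is, $\{(f,x):(x,f)\in\lambda I+A\}$ is the graph of a bounded everywhere defined operator $(\lambda I+A)^{-1}$ on $H$, and $(\lambda I+A)^{-1}x=\int_0^\infty e^{-\lambda t}S_tx\,dt$ for all $x\in H$, where the integral converges absolutely. Let $V$ be a complex vector space embedded in $H$ and let $\mathfrak a\colon V\times V\to\mathbb C$ be sesquilinear (linear in the first, antilinear in the second variable). For $\theta\in(0,\frac\pi2)$ let $\Sigma_\theta=\{z\in\mathbb C\setminus\{0\}:|\arg z|<\theta\}$. A number $\gamma\in\mathbb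 R$ is a *vertex* of $\mathfrak a$ if there is a $\theta\in(0,\frac\pi2)$ such that $\mathfrak a(u,u)-\gamma\|u\|_H^2\in\overline{\Sigma_\theta}$ for all $u\in V$. The form $\mathfrak a$ is *sectorial* if it has a vertex. A sectorial form is *closed* if there are a vertex $\gamma$ of $\mathfrak a$ and a real $\omega>-\gamma$ such that $$(u,v)\mapsto\tfrac12\bigl(\mathfrak a(u,v)+\overline{\mathfrak a(v,u)}\bigr)+\omega\,(u,v)_H$$ is a complete inner product on $V$. The *graph associated with* $\mathfrak a$ is $$\{(u,f)\in H\times H: u\in V\text{ and }\mathfrak a(u,v)=(f,v)_H\text{ for all }v\in V\}.$$ **Theorem 3.7.** Let $V$ and $H$ be complex Hilbert spaces such that $V$ is continuously embedded in $H$ (not necessarily densely). Let $\mathfrak a\colon V\times V\to\mathbb C$ be a closed, sectorial, sesquilinear form, and let $A$ be the graph in $H$ associated with $\mathfrak a$. Let $(V_n)_{n\in\mathbb N}$ be an increasing sequence of closed subspaces of $V$ such that $\bigcup_{n\in\mathbb N}V_n$ is dense in $V$. For all $n\in\mathbb N$ let $\mathfrak a_n=\mathfrak a|_{V_n\times V_n}$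 and let $A_n$ be the graph in $H$ associated with $\mathfrak a_n$. Then $-A$ and all the $-A_n$ generate degenerate semigroups on $H$, and if $S$ and $S^{(n)}$ are the degenerate semigroups generated by $-A$ and $-A_n$, respectively, then $$\lim_{n\to\infty}\ \sup_{t\in(0,T]}\|(S^{(n)}_t-S_t)f\|_H=0$$ for every $T>0$ and every $f\in H$. -/

import Mathlib

open Filter Topology MeasureTheory
open scoped ComplexConjugate

/-! ### Degenerate semigroups and graphs (linear relations) -/

section Semigroups

variable {X : Type*} [NormedAddCommGroup X] [NormedSpace ℂ X]

/-- A degenerate semigroup `S : (0,∞) → L(X)`: strongly continuous on the open half line, with the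
semigroup law, and bounded on `(0,1)`. Only the values `S t` with `0 < t` matter. -/
structure IsDegenerateSemigroup (S : ℝ → X →L[ℂ] X) : Prop where
  strongly_continuous : ∀ x : X, ContinuousOn (fun t : ℝ => S t x) (Set.Ioi 0)
  semigroup_law : ∀ t s : ℝ, 0 < t → 0 < s → S (t + s) = (S t).comp (S s)
  bounded : ∃ C : ℝ, ∀ t ∈ Set.Ioo (0 : ℝ) 1, ‖S t‖ ≤ C

/-- The graph `c I + A = {(x, c x + y) : (x, y) ∈ A}`. -/
def shiftedGraph (c : ℂ) (A : Submodule ℂ (X × X)) : Set (X × X) :=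
  {p | ∃ x y : X, (x, y) ∈ A ∧ p = (x, c • x + y)}

/-- The graph `B` is boundedly invertible with inverse the bounded operator `R`, that is,
`B⁻¹ = {(f, x) : (x, f) ∈ B}` is the graph of the everywhere defined operator `R`. -/
def HasBoundedInverse (B : Set (X × X)) (R : X →L[ℂ] X) : Prop :=
  ∀ x f : X, (x, f) ∈ B ↔ R f = x

/-- `S` is a degenerate semigroup and `-A` is its generator: for all large real `l` the graph
`l I + A` is boundedly invertible, and its inverse is the (convergent) Laplace integral of `S`. -/
def IsSemigroupGeneratedByNeg (A : Submodule ℂ (X × X)) (S : ℝ → X →L[ℂ] X) : Prop :=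
  IsDegenerateSemigroup S ∧
    ∃ ω : ℝ, ∀ l : ℝ, ω < l →
      ∃ R : X →L[ℂ] X, HasBoundedInverse (shiftedGraph (l : ℂ) A) R ∧
        ∀ x : X,
          IntegrableOn (fun t : ℝ => Real.exp (-(l * t)) • S t x) (Set.Ioi 0) ∧
            R x = ∫ t in Set.Ioi (0 : ℝ), Real.exp (-(l * t)) • S t x

end Semigroups

/-! ### Sectorial forms

A form is a sesquilinear map `a : V × V → ℂ`, linear in the first and antilinear in the second
variable, on a space `V` which is embedded into `H` by `j`. Mathlib's `inner ℂ y x` is linear in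
`x`, so that `(x, y)_H` is `inner ℂ y x`. -/

/-- The open sector `Σ_θ = {z ≠ 0 : |arg z| < θ}`. -/
def openSector (θ : ℝ) : Set ℂ := {z | z ≠ 0 ∧ |z.arg| < θ}

section Forms

variable {V : Type*} [AddCommGroup V] [Module ℂ V]
variable {H : Type*} [NormedAddCommGroup H] [InnerProductSpace ℂ H]

/-- `γ` is a vertex of `a`: there is `θ ∈ (0, π/2)` such that `a(u) - γ ‖u‖_H²` lies in the closed
sector of semiangle `θ` for all `u`. -/
def IsVertex (j : V →ₗ[ℂ] H) (a : V →ₗ[ℂ] V →ₗ⋆[ℂ] ℂ) (γ : ℝ) : Prop :=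
  ∃ θ ∈ Set.Ioo 0 (Real.pi / 2), ∀ u : V,
    a u u - ((γ * ‖j u‖ ^ 2 : ℝ) : ℂ) ∈ closure (openSector θ)

/-- Sectorial forms. -/
def IsSectorialForm (j : V →ₗ[ℂ] H) (a : V →ₗ[ℂ] V →ₗ⋆[ℂ] ℂ) : Prop :=
  ∃ γ : ℝ, IsVertex j a γ

/-- The real part `(u, v) ↦ (a(u, v) + conj (a(v, u))) / 2`. -/
noncomputable def formRealPart (a : V →ₗ[ℂ] V →ₗ⋆[ℂ] ℂ) (u v : V) : ℂ :=
  (1 / 2 : ℂ) * (a u v + conj (a v u))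

/-- `b` is a complete inner product on `V` (linear in the first variable): completeness says that
the sequences which are Cauchy for the norm `u ↦ √(b(u, u))` converge for this norm. -/
structure IsCompleteInnerProduct (b : V → V → ℂ) : Prop where
  add_left : ∀ u v w : V, b (u + v) w = b u w + b v w
  smul_left : ∀ (c : ℂ) (u v : V), b (c • u) v = c * b u v
  conj_symm : ∀ u v : V, conj (b v u) = b u v
  pos : ∀ u : V, u ≠ 0 → 0 < (b u u).re
  complete : ∀ x : ℕ → V,
    (∀ ε > 0, ∃ N : ℕ, ∀ m ≥ N, ∀ n ≥ N, √(b (x m - x n) (x m - x n)).re < ε) →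
      ∃ u : V, Tendsto (fun n => √(b (x n - u) (x n - u)).re) atTop (𝓝 0)

/-- Closed sectorial forms: `Re a + ω (·,·)_H` is a complete inner product on `V` for some `ω` above
`-γ`, where `γ` is a vertex of `a` (so that this inner product dominates the norm of `H`). -/
def IsClosedForm (j : V →ₗ[ℂ] H) (a : V →ₗ[ℂ] V →ₗ⋆[ℂ] ℂ) : Prop :=
  ∃ γ ω : ℝ, IsVertex j a γ ∧ -γ < ω ∧
    IsCompleteInnerProduct (fun u v : V => formRealPart a u v + (ω : ℂ) * inner ℂ (j v) (j u))

/-- The graph in `H` associated with `a`: all `(u, f)` with `u` in (the image of) `V` and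
`a(u, v) = (f, v)_H` for all `v ∈ V`. -/
def associatedGraph (j : V →ₗ[ℂ] H) (a : V →ₗ[ℂ] V →ₗ⋆[ℂ] ℂ) : Submodule ℂ (H × H) where
  carrier := {p | ∃ u : V, j u = p.1 ∧ ∀ v : V, a u v = inner ℂ (j v) p.2}
  zero_mem' := ⟨0, by simp, by simp⟩
  add_mem' := by
    rintro p q ⟨u, hu, hp⟩ ⟨w, hw, hq⟩
    exact ⟨u + w, by simp [hu, hw], fun v => by simp [hp v, hq v]⟩
  smul_mem' := by
    rintro c p ⟨u, hu, hp⟩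
    exact ⟨c • u, by simp [hu], fun v => by simp [hp v]⟩

/-- The restriction of `a` to `W × W`. -/
def restrictForm (a : V →ₗ[ℂ] V →ₗ⋆[ℂ] ℂ) (W : Submodule ℂ V) : W →ₗ[ℂ] W →ₗ⋆[ℂ] ℂ :=
  LinearMap.domRestrict₁₂ a W W

end Forms

/-! ### Exponentials of bounded operators. -/

section OperatorExponential

variable {X : Type*} [NormedAddCommGroup X] [NormedSpace ℂ X]

/-! After adding `w (·,·)_H`, the form is bounded and coercive on `V`, hence represented by some `L`
with `Re (Lu, u) ≥ α ‖u‖²`. Lax–Milgram gives `Q_l = j (L + l j*j)⁻¹ j*`, a pseudo-resolvent with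
`‖Q_l‖ ≤ 1/l`. Since `j` need not have dense range, `Q_l` may have a kernel, namely `(ran j)^⊥`; but
`ran Q_1² + ker Q_1` is always dense (`isContractivePseudoresolvent_formResolvent`).

This suffices for a Hille–Yosida construction. On `ran Q_1²` the exponentials of the Yosida
approximations converge at the rate `4 t ‖h‖ / l` at `Q_1² h`, and on `ker Q_1` they equal
`e^{-tl}`, which tends to `0`. The limit is a semigroup that vanishes on `ker Q_1` and has Laplace
transform `Q`; the factor `e^{wt}` undoes the shift.

Céa's lemma gives strong convergence of the resolvents of the restricted forms. A Trotter–Kato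
argument (`eventually_norm_sub_le`) transfers it to the semigroups, because the Yosida rate is the
same for all `n`. Uniformity down to `t = 0` holds for every `f`, even off the closure of `ran j`: a
vector orthogonal to `j V` is orthogonal to each `j V_n`, so all the semigroups annihilate it.
Finally, injectivity of the Laplace transform identifies any generated semigroup with the
constructed one. -/

theorem norm_pow_apply_le {A : X →L[ℂ] X} {c : ℝ} (hc : 0 ≤ c) (hA : ∀ x, ‖A x‖ ≤ c * ‖x‖)
    (k : ℕ) (x : X) : ‖(A ^ k) x‖ ≤ c ^ k * ‖x‖ := by
  induction k generalizing x with
  | zero => simp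
  | succ k ih =>
    rw [pow_succ, mul_apply_eq_comp]
    calc _ ≤ c ^ k * ‖A x‖ := ih _
      _ ≤ c ^ k * (c * ‖x‖) := by gcongr; exact hA x
      _ = _ := by ring

variable [CompleteSpace X]

theorem hasSum_exp_apply (A : X →L[ℂ] X) (x : X) :
    HasSum (fun k : ℕ => ((k.factorial : ℝ)⁻¹) • (A ^ k) x) (NormedSpace.exp A x) := by
  have h := NormedSpace.exp_series_hasSum_exp' (𝕂 := ℝ) A
  have h2 := h.map (ContinuousLinearMap.apply ℂ X x : (X →L[ℂ] X) →+ X)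
    (ContinuousLinearMap.apply ℂ X x).continuous
  simpa [Function.comp_def] using h2

theorem hasSum_real_exp (c : ℝ) :
    HasSum (fun k : ℕ => ((k.factorial : ℝ)⁻¹) * c ^ k) (Real.exp c) := by
  have := NormedSpace.expSeries_div_hasSum_exp c
  rw [← Real.exp_eq_exp_ℝ] at this
  simpa [div_eq_inv_mul] using this

theorem norm_exp_apply_le {A : X →L[ℂ] X} {c : ℝ} (hc : 0 ≤ c) (hA : ∀ x, ‖A x‖ ≤ c * ‖x‖)
    (x : X) : ‖NormedSpace.exp A x‖ ≤ Real.exp c * ‖x‖ := by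
  rw [← (hasSum_exp_apply A x).tsum_eq]
  refine tsum_of_norm_bounded ((hasSum_real_exp c).mul_right ‖x‖) fun k => ?_
  rw [norm_smul, mul_assoc, Real.norm_of_nonneg (by positivity)]
  gcongr
  exact norm_pow_apply_le hc hA k x

theorem exp_apply_of_apply_eq_smul {A : X →L[ℂ] X} {c : ℝ} {x : X} (h : A x = c • x) :
    NormedSpace.exp A x = Real.exp c • x := by
  have hp : ∀ k : ℕ, (A ^ k) x = c ^ k • x := by
    intro k
    induction k with
    | zero => simp
    | succ k ih =>
      rw [pow_succ', mul_apply_eq_comp, ih, A.map_smul_of_tower, h, smul_smul, pow_succ]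
  refine (hasSum_exp_apply A x).unique ?_
  simp_rw [hp, smul_smul]
  exact (hasSum_real_exp c).smul_const x

/-- By commutation, `s ↦ e^{sA} e^{(t-s)B} x` has derivative `e^{sA} e^{(t-s)B} (A - B) x`, of norm
at most `‖Ax - Bx‖`; integrate over `[0, t]`. -/
theorem norm_exp_smul_sub_exp_smul_le {A B : X →L[ℂ] X} (hAB : Commute A B)
    (hA : ∀ t : ℝ, 0 ≤ t → ∀ x, ‖NormedSpace.exp (t • A) x‖ ≤ ‖x‖)
    (hB : ∀ t : ℝ, 0 ≤ t → ∀ x, ‖NormedSpace.exp (t • B) x‖ ≤ ‖x‖) {t : ℝ} (ht : 0 ≤ t) (x : X) :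
    ‖NormedSpace.exp (t • A) x - NormedSpace.exp (t • B) x‖ ≤ t * ‖A x - B x‖ := by
  have hd : ∀ s : ℝ, HasDerivAt
      (fun s : ℝ => (NormedSpace.exp (s • A) * NormedSpace.exp ((t - s) • B)) x)
      ((NormedSpace.exp (s • A) * NormedSpace.exp ((t - s) • B)) (A x - B x)) s := by
    intro s
    have h1 := hasDerivAt_exp_smul_const (𝕂 := ℝ) A s
    have h2 : HasDerivAt (fun s : ℝ => NormedSpace.exp ((t - s) • B))
        (-(NormedSpace.exp ((t - s) • B) * B)) s := by
      have := (hasDerivAt_exp_smul_const (𝕂 := ℝ) B (t - s)).scomp s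
        ((hasDerivAt_id s).const_sub t)
      rw [neg_one_smul] at this
      exact this
    have h3 := h1.mul h2
    have h4 := ((ContinuousLinearMap.apply ℂ X x).restrictScalars ℝ).hasFDerivAt.comp_hasDerivAt
      s h3
    refine h4.congr_deriv ?_
    have hc : A * NormedSpace.exp ((t - s) • B) = NormedSpace.exp ((t - s) • B) * A :=
      ((hAB.smul_right (t - s)).exp_right).eq
    rw [mul_assoc, hc]
    simp [sub_eq_add_neg]
  have := norm_image_sub_le_of_norm_deriv_le_segment' (a := 0) (b := t) (C := ‖A x - B x‖)
    (fun s _ => (hd s).hasDerivWithinAt)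
    (fun s hs => (hA s hs.1 _).trans (hB (t - s) (by linarith [hs.2]) _)) t ⟨ht, le_rfl⟩
  simpa [mul_comm] using this

/-- Every power converges strongly, and the exponential series is dominated termwise, with `t`
replaced by `T`; this yields uniformity in `t`. -/
theorem eventually_norm_exp_smul_sub_le {B : ℕ → X →L[ℂ] X} {B' : X →L[ℂ] X} {c : ℝ} (hc : 0 ≤ c)
    (hB : ∀ i x, ‖B i x‖ ≤ c * ‖x‖) (h : ∀ x, Tendsto (fun i => B i x) atTop (𝓝 (B' x)))
    (T : ℝ) (x : X) {ε : ℝ} (hε : 0 < ε) :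
    ∀ᶠ i in atTop, ∀ t ∈ Set.Icc 0 T,
      ‖NormedSpace.exp (t • B i) x - NormedSpace.exp (t • B') x‖ ≤ ε := by
  by_cases hT : 0 ≤ T
  swap
  · exact Eventually.of_forall fun i t ht => absurd (ht.1.trans ht.2) hT
  have hB' : ∀ x, ‖B' x‖ ≤ c * ‖x‖ := fun x =>
    le_of_tendsto (h x).norm (Eventually.of_forall fun i => hB i x)
  have hpow : ∀ k : ℕ, ∀ x, Tendsto (fun i => (B i ^ k) x) atTop (𝓝 ((B' ^ k) x)) := by
    intro k
    induction k with
    | zero => intro x; simp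
    | succ k ih =>
      intro x
      have h1 : Tendsto (fun i => (B i ^ k) (B i x - B' x)) atTop (𝓝 0) := by
        refine squeeze_zero_norm (fun i => norm_pow_apply_le hc (hB i) k _) ?_
        simpa using ((h x).sub_const (B' x)).norm.const_mul (c ^ k)
      have h2 := h1.add (ih (B' x))
      simpa [pow_succ] using h2
  set b : ℕ → ℝ := fun k => ((k.factorial : ℝ)⁻¹) * (T * c) ^ k * (2 * ‖x‖)
  have hb : Summable b := ((hasSum_real_exp (T * c)).summable).mul_right _
  have hterm : ∀ i k, ((k.factorial : ℝ)⁻¹) * T ^ k * ‖(B i ^ k) x - (B' ^ k) x‖ ≤ b k := by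
    intro i k
    have h1 := norm_pow_apply_le hc (hB i) k x
    have h2 := norm_pow_apply_le hc hB' k x
    calc _ ≤ ((k.factorial : ℝ)⁻¹) * T ^ k * (c ^ k * ‖x‖ + c ^ k * ‖x‖) := by
          gcongr
          exact (norm_sub_le _ _).trans (add_le_add h1 h2)
      _ = b k := by simp only [b, mul_pow]; ring
  have hlim : Tendsto (fun i => ∑' k : ℕ, ((k.factorial : ℝ)⁻¹) * T ^ k * ‖(B i ^ k) x - (B' ^ k) x‖)
      atTop (𝓝 (∑' k : ℕ, (0 : ℝ))) := by
    refine tendsto_tsum_of_dominated_convergence hb (fun k => ?_)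
      (Eventually.of_forall fun i k => ?_)
    · simpa using (((hpow k x).sub_const ((B' ^ k) x)).norm).const_mul
        (((k.factorial : ℝ)⁻¹) * T ^ k)
    · rw [Real.norm_of_nonneg (by positivity)]
      exact hterm i k
  rw [tsum_zero] at hlim
  filter_upwards [hlim.eventually (ge_mem_nhds hε)] with i hi t ht
  refine le_trans ?_ hi
  have h1 := (hasSum_exp_apply (t • B i) x).sub (hasSum_exp_apply (t • B') x)
  rw [← h1.tsum_eq]
  have hs : Summable fun k : ℕ => ((k.factorial : ℝ)⁻¹) * T ^ k * ‖(B i ^ k) x - (B' ^ k) x‖ :=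
    hb.of_nonneg_of_le (fun k => by positivity) (hterm i)
  refine tsum_of_norm_bounded hs.hasSum fun k => ?_
  rw [← smul_sub, norm_smul, Real.norm_of_nonneg (by positivity), mul_assoc]
  gcongr
  rw [smul_pow, smul_pow, smul_apply, smul_apply,
    ← smul_sub, norm_smul, Real.norm_of_nonneg (pow_nonneg ht.1 _)]
  gcongr
  exacts [ht.1, ht.2]

end OperatorExponential

/-! ### Contractive pseudo-resolvents and their Yosida approximations. -/

section Pseudoresolvent

variable {X : Type*} [NormedAddCommGroup X] [NormedSpace ℂ X]

/-- A contractive pseudo-resolvent `l ↦ Q l`, `l > 0`, for which the space is spanned, up to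
closure, by the range of `(Q 1)²` and the kernel of `Q 1`. -/
structure IsContractivePseudoresolvent (Q : ℝ → X →L[ℂ] X) : Prop where
  sub_eq : ∀ l m : ℝ, 0 < l → 0 < m → ∀ x, Q l x - Q m x = (m - l) • Q l (Q m x)
  norm_le : ∀ l : ℝ, 0 < l → ∀ x, ‖Q l x‖ ≤ l⁻¹ * ‖x‖
  dense : Dense {x | ∃ h k, Q 1 k = 0 ∧ x = Q 1 (Q 1 h) + k}

/-- The Yosida approximation `l² Q l - l` of the generator. -/
noncomputable def yosidaGenerator (Q : ℝ → X →L[ℂ] X) (l : ℝ) : X →L[ℂ] X :=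
  (l ^ 2) • Q l - l • (1 : X →L[ℂ] X)

/-- `T` is the strong limit on `(0, ∞)` of the semigroups generated by the Yosida approximations. -/
def IsYosidaLimit (Q T : ℝ → X →L[ℂ] X) : Prop :=
  ∀ t : ℝ, 0 < t → ∀ x,
    Tendsto (fun l => NormedSpace.exp (t • yosidaGenerator Q l) x) atTop (𝓝 (T t x))

theorem yosidaGenerator_apply (Q : ℝ → X →L[ℂ] X) (l : ℝ) (x : X) :
    yosidaGenerator Q l x = (l ^ 2) • Q l x - l • x := by
  simp [yosidaGenerator]

namespace IsContractivePseudoresolvent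

variable {Q : ℝ → X →L[ℂ] X}

theorem comm_apply (hQ : IsContractivePseudoresolvent Q) {l m : ℝ} (hl : 0 < l) (hm : 0 < m)
    (x : X) : Q l (Q m x) = Q m (Q l x) := by
  rcases eq_or_ne l m with rfl | hne
  · rfl
  have h1 := hQ.sub_eq l m hl hm x
  have h2 := hQ.sub_eq m l hm hl x
  have h3 : (m - l) • (Q l (Q m x) - Q m (Q l x)) = 0 := by
    linear_combination (norm := module) (-1 : ℝ) • h1 - h2
  rcases smul_eq_zero.1 h3 with h | h
  · exact absurd (sub_eq_zero.1 h).symm hne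
  · exact sub_eq_zero.1 h

theorem commute_yosidaGenerator (hQ : IsContractivePseudoresolvent Q) {l m : ℝ} (hl : 0 < l)
    (hm : 0 < m) : Commute (yosidaGenerator Q l) (yosidaGenerator Q m) := by
  have h : Commute (Q l) (Q m) := by
    ext x
    exact hQ.comm_apply hl hm x
  unfold yosidaGenerator
  refine Commute.sub_left (Commute.sub_right ?_ ?_) ?_
  · exact (h.smul_left _).smul_right _
  · exact (Commute.one_right _).smul_right _
  · exact (Commute.one_left _).smul_left _

theorem norm_yosidaGenerator_le (hQ : IsContractivePseudoresolvent Q) {l : ℝ} (hl : 0 < l)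
    (x : X) : ‖yosidaGenerator Q l x‖ ≤ (2 * l) * ‖x‖ := by
  rw [yosidaGenerator_apply]
  have h := hQ.norm_le l hl x
  calc _ ≤ ‖(l ^ 2) • Q l x‖ + ‖l • x‖ := norm_sub_le _ _
    _ = l ^ 2 * ‖Q l x‖ + l * ‖x‖ := by
        rw [norm_smul, norm_smul, Real.norm_of_nonneg hl.le, Real.norm_of_nonneg (by positivity)]
    _ ≤ l ^ 2 * (l⁻¹ * ‖x‖) + l * ‖x‖ := by gcongr
    _ = (2 * l) * ‖x‖ := by field_simp; ring

/-- Formally `Q 1 = (1 + A)⁻¹`, so `-A` sends `Q 1 h` to `Q 1 h - h`. The first summand is thus the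
limiting generator at `Q 1 (Q 1 h)`, and the second is an error of order `1/l`. -/
theorem yosidaGenerator_apply_sq (hQ : IsContractivePseudoresolvent Q) {l : ℝ} (hl : 0 < l)
    (h : X) : yosidaGenerator Q l (Q 1 (Q 1 h)) =
      Q 1 (Q 1 h - h) + Q l (Q 1 (Q 1 h - h) - (Q 1 h - h)) := by
  have h1 := hQ.sub_eq l 1 hl one_pos (Q 1 h)
  have h2 := hQ.sub_eq l 1 hl one_pos h
  rw [yosidaGenerator_apply]
  simp only [map_sub]
  linear_combination (norm := module) (1 + l) • h1 - h2

/-- The second factor `Q 1` buys the rate `1/l`. The constant uses only contractivity (`‖Q 1 x - x‖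
≤ 2 ‖x‖`, twice), so it is the same for all pseudo-resolvents. -/
theorem norm_yosidaGenerator_sub_le (hQ : IsContractivePseudoresolvent Q) {l : ℝ} (hl : 0 < l)
    (h : X) : ‖yosidaGenerator Q l (Q 1 (Q 1 h)) - Q 1 (Q 1 h - h)‖ ≤ 4 * l⁻¹ * ‖h‖ := by
  rw [hQ.yosidaGenerator_apply_sq hl, add_sub_cancel_left]
  have h1 : ∀ x, ‖Q 1 x‖ ≤ ‖x‖ := fun x => by simpa using hQ.norm_le 1 one_pos x
  calc _ ≤ l⁻¹ * ‖Q 1 (Q 1 h - h) - (Q 1 h - h)‖ := hQ.norm_le l hl _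
    _ ≤ l⁻¹ * (‖Q 1 h - h‖ + ‖Q 1 h - h‖) := by
        gcongr; exact (norm_sub_le _ _).trans (add_le_add_left (h1 _) _)
    _ ≤ l⁻¹ * ((‖h‖ + ‖h‖) + (‖h‖ + ‖h‖)) := by
        have : ‖Q 1 h - h‖ ≤ ‖h‖ + ‖h‖ := (norm_sub_le _ _).trans (add_le_add_left (h1 _) _)
        gcongr
    _ = _ := by ring

theorem apply_eq_zero (hQ : IsContractivePseudoresolvent Q) {l : ℝ} (hl : 0 < l) {x : X}
    (hx : Q 1 x = 0) : Q l x = 0 := by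
  simpa [hx] using hQ.sub_eq l 1 hl one_pos x

variable [CompleteSpace X]

/-- The scalar part splits off: `e^{t l² Q_l}` has norm at most `e^{tl}`, which `e^{-tl}` cancels.
-/
theorem norm_exp_yosidaGenerator_le (hQ : IsContractivePseudoresolvent Q) {l : ℝ} (hl : 0 < l)
    {t : ℝ} (ht : 0 ≤ t) (x : X) : ‖NormedSpace.exp (t • yosidaGenerator Q l) x‖ ≤ ‖x‖ := by
  have h1 : t • yosidaGenerator Q l = (t * l ^ 2) • Q l + (-(t * l)) • (1 : X →L[ℂ] X) := by
    rw [yosidaGenerator]; module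
  have hc : Commute ((t * l ^ 2) • Q l) ((-(t * l)) • (1 : X →L[ℂ] X)) :=
    (Commute.one_right _).smul_right _
  let : NormedAlgebra ℚ (X →L[ℂ] X) := NormedAlgebra.restrictScalars ℚ ℝ _
  rw [h1, NormedSpace.exp_add_of_commute hc, mul_apply_eq_comp,
    exp_apply_of_apply_eq_smul (c := -(t * l)) (x := x) (by simp)]
  have h2 : ∀ y, ‖((t * l ^ 2) • Q l) y‖ ≤ (t * l) * ‖y‖ := fun y => by
    rw [smul_apply, norm_smul, Real.norm_of_nonneg (by positivity)]
    calc _ ≤ t * l ^ 2 * (l⁻¹ * ‖y‖) := by gcongr; exact hQ.norm_le l hl y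
      _ = _ := by field_simp
  refine (norm_exp_apply_le (by positivity) h2 _).trans ?_
  rw [norm_smul, Real.norm_of_nonneg (Real.exp_nonneg _), ← mul_assoc, ← Real.exp_add]
  simp

theorem exp_yosidaGenerator_apply_of_ker (hQ : IsContractivePseudoresolvent Q) {l : ℝ} (hl : 0 < l)
    (t : ℝ) {x : X} (hx : Q 1 x = 0) :
    NormedSpace.exp (t • yosidaGenerator Q l) x = Real.exp (-(t * l)) • x := by
  refine exp_apply_of_apply_eq_smul ?_
  rw [smul_apply, yosidaGenerator_apply, hQ.apply_eq_zero hl hx]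
  module

theorem norm_exp_yosidaGenerator_sub_le (hQ : IsContractivePseudoresolvent Q) {l m : ℝ}
    (hl : 0 < l) (hm : 0 < m) {t : ℝ} (ht : 0 ≤ t) (h : X) :
    ‖NormedSpace.exp (t • yosidaGenerator Q l) (Q 1 (Q 1 h)) -
      NormedSpace.exp (t • yosidaGenerator Q m) (Q 1 (Q 1 h))‖ ≤
      t * (4 * l⁻¹ * ‖h‖ + 4 * m⁻¹ * ‖h‖) := by
  refine (norm_exp_smul_sub_exp_smul_le (hQ.commute_yosidaGenerator hl hm)
    (fun _ => hQ.norm_exp_yosidaGenerator_le hl) (fun _ => hQ.norm_exp_yosidaGenerator_le hm)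
    ht _).trans ?_
  gcongr
  rw [← sub_sub_sub_cancel_right _ _ (Q 1 (Q 1 h - h))]
  exact (norm_sub_le _ _).trans (add_le_add (hQ.norm_yosidaGenerator_sub_le hl h)
    (hQ.norm_yosidaGenerator_sub_le hm h))

theorem cauchySeq_exp_yosidaGenerator (hQ : IsContractivePseudoresolvent Q) {t : ℝ} (ht : 0 < t)
    (x : X) : CauchySeq fun l => NormedSpace.exp (t • yosidaGenerator Q l) x := by
  refine Metric.cauchySeq_iff'.2 fun ε hε => ?_
  obtain ⟨_, hxd, h, k, hk, rfl⟩ := Metric.dense_iff.1 hQ.dense x (ε / 4) (by positivity)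
  set d := Q 1 (Q 1 h) + k
  rw [Metric.mem_ball, dist_comm, dist_eq_norm] at hxd
  have hlim : Tendsto (fun l : ℝ => t * (4 * l⁻¹ * ‖h‖ + 4 * l⁻¹ * ‖h‖)) atTop (𝓝 0) := by
    have := (((tendsto_inv_atTop_zero (𝕜 := ℝ)).const_mul 4).mul_const ‖h‖)
    simpa using (this.add this).const_mul t
  have hlim2 : Tendsto (fun l : ℝ => Real.exp (-(t * l)) * ‖k‖) atTop (𝓝 0) := by
    simpa using (Real.tendsto_exp_neg_atTop_nhds_zero.comp
      (tendsto_id.const_mul_atTop ht)).mul_const ‖k‖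
  -- Error budget: `2 · ε/4` for replacing `x` by `d`, `ε/4` on the range and `2 · ε/8` on the
  -- kernel.
  obtain ⟨N, hN⟩ := eventually_atTop.1 ((eventually_gt_atTop (0 : ℝ)).and
    ((hlim.eventually (gt_mem_nhds (show 0 < ε / 4 by positivity))).and
      (hlim2.eventually (gt_mem_nhds (show 0 < ε / 8 by positivity)))))
  obtain ⟨hN0, hN1, hN2⟩ := hN N le_rfl
  refine ⟨N, fun l hl => ?_⟩
  obtain ⟨hl0, -, hl2⟩ := hN l hl
  rw [dist_eq_norm]
  have e1 := hQ.norm_exp_yosidaGenerator_le hl0 ht.le (x - d)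
  have e2 := hQ.norm_exp_yosidaGenerator_le hN0 ht.le (x - d)
  have e3 := hQ.norm_exp_yosidaGenerator_sub_le hl0 hN0 ht.le h
  have e3' : t * (4 * l⁻¹ * ‖h‖ + 4 * N⁻¹ * ‖h‖) ≤ t * (4 * N⁻¹ * ‖h‖ + 4 * N⁻¹ * ‖h‖) := by
    gcongr
  have e4 := hQ.exp_yosidaGenerator_apply_of_ker hl0 t hk
  have e5 := hQ.exp_yosidaGenerator_apply_of_ker hN0 t hk
  have e4' := congrArg norm e4
  have e5' := congrArg norm e5
  rw [norm_smul, Real.norm_of_nonneg (Real.exp_nonneg _)] at e4' e5'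
  set E := NormedSpace.exp (t • yosidaGenerator Q l)
  set F := NormedSpace.exp (t • yosidaGenerator Q N)
  have hdec : E x - F x = E (x - d) - F (x - d) + (E (Q 1 (Q 1 h)) - F (Q 1 (Q 1 h)))
      + (E k - F k) := by
    simp only [d, map_sub, map_add]; abel
  rw [hdec]
  have n1 := norm_add₃_le (a := E (x - d) - F (x - d)) (b := E (Q 1 (Q 1 h)) - F (Q 1 (Q 1 h)))
    (c := E k - F k)
  have n2 := norm_sub_le (E (x - d)) (F (x - d))
  have n3 := norm_sub_le (E k) (F k)
  linarith

theorem exists_isYosidaLimit (hQ : IsContractivePseudoresolvent Q) : ∃ T, IsYosidaLimit Q T := by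
  have h : ∀ t : ℝ, ∃ T : X →L[ℂ] X, 0 < t → ∀ x,
      Tendsto (fun l => NormedSpace.exp (t • yosidaGenerator Q l) x) atTop (𝓝 (T x)) := by
    intro t
    by_cases ht : 0 < t
    · choose f hf using fun x => cauchySeq_tendsto_of_complete (hQ.cauchySeq_exp_yosidaGenerator ht x)
      exact ⟨continuousLinearMapOfTendsto _ (tendsto_pi_nhds.2 hf), fun _ => hf⟩
    · exact ⟨0, fun h => absurd h ht⟩
  choose T hT using h
  exact ⟨T, hT⟩

end IsContractivePseudoresolvent

end Pseudoresolvent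

/-! ### The limit semigroup: continuity, Laplace transform, Trotter–Kato convergence. -/

section YosidaLimit

variable {X : Type*} [NormedAddCommGroup X] [NormedSpace ℂ X] [CompleteSpace X]

namespace IsYosidaLimit

variable {Q T : ℝ → X →L[ℂ] X}

theorem norm_le (hT : IsYosidaLimit Q T) (hQ : IsContractivePseudoresolvent Q) {t : ℝ}
    (ht : 0 < t) (x : X) : ‖T t x‖ ≤ ‖x‖ :=
  le_of_tendsto (hT t ht x).norm <| (eventually_gt_atTop 0).mono fun _ hl =>
    hQ.norm_exp_yosidaGenerator_le hl ht.le x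

theorem add_apply (hT : IsYosidaLimit Q T) (hQ : IsContractivePseudoresolvent Q) {t s : ℝ}
    (ht : 0 < t) (hs : 0 < s) (x : X) : T (t + s) x = T t (T s x) := by
  refine tendsto_nhds_unique (hT (t + s) (add_pos ht hs) x) ?_
  have h1 : Tendsto (fun l => NormedSpace.exp (t • yosidaGenerator Q l)
      (NormedSpace.exp (s • yosidaGenerator Q l) x - T s x)) atTop (𝓝 0) := by
    refine squeeze_zero_norm' ((eventually_gt_atTop 0).mono fun l hl =>
      hQ.norm_exp_yosidaGenerator_le hl ht.le _) ?_
    simpa using ((hT s hs x).sub_const (T s x)).norm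
  have h2 := h1.add (hT t ht (T s x))
  rw [zero_add] at h2
  refine h2.congr fun l => ?_
  let : NormedAlgebra ℚ (X →L[ℂ] X) := NormedAlgebra.restrictScalars ℚ ℝ _
  have hc : Commute (t • yosidaGenerator Q l) (s • yosidaGenerator Q l) :=
    ((Commute.refl _).smul_left _).smul_right _
  rw [add_smul, NormedSpace.exp_add_of_commute hc, mul_apply_eq_comp, map_sub, sub_add_cancel]

theorem norm_exp_sub_le (hT : IsYosidaLimit Q T) (hQ : IsContractivePseudoresolvent Q) {l t : ℝ}
    (hl : 0 < l) (ht : 0 < t) (h : X) :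
    ‖NormedSpace.exp (t • yosidaGenerator Q l) (Q 1 (Q 1 h)) - T t (Q 1 (Q 1 h))‖ ≤
      t * (4 * l⁻¹ * ‖h‖) := by
  have h1 := ((hT t ht (Q 1 (Q 1 h))).const_sub
    (NormedSpace.exp (t • yosidaGenerator Q l) (Q 1 (Q 1 h)))).norm
  have h2 : Tendsto (fun m : ℝ => t * (4 * l⁻¹ * ‖h‖ + 4 * m⁻¹ * ‖h‖)) atTop
      (𝓝 (t * (4 * l⁻¹ * ‖h‖))) := by
    simpa using ((((tendsto_inv_atTop_zero (𝕜 := ℝ)).const_mul 4).mul_const ‖h‖).const_add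
      (4 * l⁻¹ * ‖h‖)).const_mul t
  exact le_of_tendsto_of_tendsto h1 h2 <| (eventually_gt_atTop 0).mono fun m hm =>
    hQ.norm_exp_yosidaGenerator_sub_le hl hm ht.le h

theorem apply_of_ker (hT : IsYosidaLimit Q T) (hQ : IsContractivePseudoresolvent Q) {t : ℝ}
    (ht : 0 < t) {x : X} (hx : Q 1 x = 0) : T t x = 0 := by
  refine tendsto_nhds_unique (hT t ht x) ?_
  have h : Tendsto (fun l : ℝ => Real.exp (-(t * l)) • x) atTop (𝓝 ((0 : ℝ) • x)) :=
    (Real.tendsto_exp_neg_atTop_nhds_zero.comp (tendsto_id.const_mul_atTop ht)).smul_const x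
  rw [zero_smul] at h
  exact h.congr' <| (eventually_gt_atTop 0).mono fun l hl =>
    (hQ.exp_yosidaGenerator_apply_of_ker hl t hx).symm

/-- On the dense set the Yosida exponentials converge uniformly on bounded intervals. Contractivity
makes the set of `x` with a continuous orbit closed. -/
theorem continuousOn (hT : IsYosidaLimit Q T) (hQ : IsContractivePseudoresolvent Q) (x : X) :
    ContinuousOn (fun t => T t x) (Set.Ioi 0) := by
  refine hQ.dense.induction (P := fun x => ContinuousOn (fun t => T t x) (Set.Ioi 0)) ?_ ?_ x
  · rintro _ ⟨h, k, hk, rfl⟩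
    have h1 : ContinuousOn (fun t => T t (Q 1 (Q 1 h))) (Set.Ioi 0) := by
      intro t₀ ht₀
      have hu : TendstoUniformlyOn
          (fun (l t : ℝ) => NormedSpace.exp (t • yosidaGenerator Q l) (Q 1 (Q 1 h)))
          (fun t => T t (Q 1 (Q 1 h))) atTop (Set.Ioo 0 (t₀ + 1)) := by
        rw [Metric.tendstoUniformlyOn_iff]
        intro ε hε
        have hlim : Tendsto (fun l : ℝ => (t₀ + 1) * (4 * l⁻¹ * ‖h‖)) atTop (𝓝 0) := by
          simpa using (((tendsto_inv_atTop_zero (𝕜 := ℝ)).const_mul 4).mul_const ‖h‖).const_mul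
            (t₀ + 1)
        filter_upwards [hlim.eventually (gt_mem_nhds hε), eventually_gt_atTop 0] with l hl hl0 t ht
        rw [dist_comm, dist_eq_norm]
        refine (hT.norm_exp_sub_le hQ hl0 ht.1 h).trans_lt (lt_of_le_of_lt ?_ hl)
        gcongr
        exact ht.2.le
      have hc := hu.continuousOn (Frequently.of_forall fun l => by
        have : Continuous fun t : ℝ => NormedSpace.exp (t • yosidaGenerator Q l) :=
          continuous_iff_continuousAt.2 fun t =>
            (hasDerivAt_exp_smul_const (𝕂 := ℝ) (yosidaGenerator Q l) t).continuousAt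
        exact (this.clm_apply continuous_const).continuousOn)
      exact (hc.continuousAt (Ioo_mem_nhds ht₀ (lt_add_one t₀))).continuousWithinAt
    refine h1.congr fun t ht => ?_
    simp [hT.apply_of_ker hQ ht hk]
  · refine IsSeqClosed.isClosed fun u y hu huy => ?_
    refine TendstoUniformlyOn.continuousOn (F := fun n t => T t (u n)) (p := atTop) ?_
      (Frequently.of_forall hu)
    rw [Metric.tendstoUniformlyOn_iff]
    intro ε hε
    filter_upwards [Metric.tendsto_nhds.1 huy ε hε] with n hn t ht
    rw [dist_comm, dist_eq_norm, ← map_sub]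
    exact (hT.norm_le hQ ht _).trans_lt (by rwa [← dist_eq_norm])

theorem isDegenerateSemigroup_exp_smul (hT : IsYosidaLimit Q T)
    (hQ : IsContractivePseudoresolvent Q) (w : ℝ) :
    IsDegenerateSemigroup fun t => Real.exp (w * t) • T t where
  strongly_continuous x := by
    have := hT.continuousOn hQ x
    simp only [smul_apply]
    fun_prop
  semigroup_law t s ht hs := by
    ext x
    simp only [smul_apply, ContinuousLinearMap.comp_apply, hT.add_apply hQ ht hs, mul_add,
      Real.exp_add, ContinuousLinearMap.map_smul_of_tower, smul_smul]
  bounded := by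
    refine ⟨Real.exp |w|, fun t ht => ?_⟩
    refine ContinuousLinearMap.opNorm_le_bound _ (Real.exp_nonneg _) fun x => ?_
    rw [smul_apply, norm_smul, Real.norm_of_nonneg (Real.exp_nonneg _)]
    gcongr
    · calc w * t ≤ |w| * t := by gcongr; exacts [ht.1.le, le_abs_self w]
        _ ≤ |w| * 1 := by gcongr; exact ht.2.le
        _ = |w| := mul_one _
    · exact hT.norm_le hQ ht.1 x

theorem integrableOn (hT : IsYosidaLimit Q T) (hQ : IsContractivePseudoresolvent Q) {m : ℝ}
    (hm : 0 < m) (x : X) : IntegrableOn (fun t => Real.exp (-(m * t)) • T t x) (Set.Ioi 0) := by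
  have hc := hT.continuousOn hQ x
  refine Integrable.mono' (g := fun t => Real.exp (-m * t) * ‖x‖)
    ((exp_neg_integrableOn_Ioi 0 hm).mul_const _)
    (ContinuousOn.aestronglyMeasurable (by fun_prop) measurableSet_Ioi) ?_
  filter_upwards [ae_restrict_mem measurableSet_Ioi] with t ht
  rw [norm_smul, Real.norm_of_nonneg (Real.exp_nonneg _), neg_mul]
  gcongr
  exact hT.norm_le hQ ht x

/-- For bounded generators `B`, the integrand `e^{-mt} e^{tB} (m - B) f` is the derivative of
`-e^{-mt} e^{tB} f`, so its integral is `f`. Dominated convergence carries this to the limit. -/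
theorem integral_apply_range (hT : IsYosidaLimit Q T) (hQ : IsContractivePseudoresolvent Q) {m : ℝ}
    (hm : 0 < m) (h : X) :
    ∫ t in Set.Ioi (0 : ℝ), Real.exp (-(m * t)) • T t (m • Q 1 (Q 1 h) - Q 1 (Q 1 h - h)) =
      Q 1 (Q 1 h) := by
  set f := Q 1 (Q 1 h)
  set g := Q 1 (Q 1 h - h)
  have hcont : ∀ l : ℝ, Continuous fun t : ℝ => NormedSpace.exp (t • yosidaGenerator Q l) :=
    fun l => continuous_iff_continuousAt.2 fun t =>
      (hasDerivAt_exp_smul_const (𝕂 := ℝ) (yosidaGenerator Q l) t).continuousAt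
  have hint : ∀ l : ℝ, 0 < l → ∀ y, IntegrableOn (fun t : ℝ => Real.exp (-(m * t)) •
      NormedSpace.exp (t • yosidaGenerator Q l) y) (Set.Ioi 0) := by
    intro l hl y
    have := hcont l
    refine Integrable.mono' (g := fun t => Real.exp (-m * t) * ‖y‖)
      ((exp_neg_integrableOn_Ioi 0 hm).mul_const _)
      (Continuous.aestronglyMeasurable (by fun_prop)) ?_
    filter_upwards [ae_restrict_mem measurableSet_Ioi] with t ht
    rw [norm_smul, Real.norm_of_nonneg (Real.exp_nonneg _), neg_mul]
    gcongr
    exact hQ.norm_exp_yosidaGenerator_le hl (le_of_lt ht) y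
  have hval : ∀ l : ℝ, 0 < l → ∫ t in Set.Ioi (0 : ℝ), Real.exp (-(m * t)) •
      NormedSpace.exp (t • yosidaGenerator Q l) (m • f - yosidaGenerator Q l f) = f := by
    intro l hl
    have hd : ∀ t : ℝ, HasDerivAt (fun t : ℝ => -(Real.exp (-(m * t)) •
        NormedSpace.exp (t • yosidaGenerator Q l) f))
        (Real.exp (-(m * t)) •
          NormedSpace.exp (t • yosidaGenerator Q l) (m • f - yosidaGenerator Q l f)) t := by
      intro t
      have h1 := ((ContinuousLinearMap.apply ℂ X f).restrictScalars ℝ).hasFDerivAt.comp_hasDerivAt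
        t (hasDerivAt_exp_smul_const (𝕂 := ℝ) (yosidaGenerator Q l) t)
      have h2 : HasDerivAt (fun t : ℝ => Real.exp (-(m * t))) (Real.exp (-(m * t)) * (-m)) t := by
        simpa using (((hasDerivAt_id t).const_mul m).neg).exp
      refine (h2.smul h1).neg.congr_deriv ?_
      simp only [Function.comp, ContinuousLinearMap.coe_restrictScalars', map_sub,
        ContinuousLinearMap.apply_apply, mul_apply_eq_comp, ContinuousLinearMap.map_smul_of_tower]
      module
    have hlim : Tendsto (fun t : ℝ => -(Real.exp (-(m * t)) •
        NormedSpace.exp (t • yosidaGenerator Q l) f)) atTop (𝓝 0) := by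
      refine squeeze_zero_norm' (a := fun t => Real.exp (-(m * t)) * ‖f‖) ?_ ?_
      · filter_upwards [eventually_ge_atTop 0] with t ht
        rw [norm_neg, norm_smul, Real.norm_of_nonneg (Real.exp_nonneg _)]
        gcongr
        exact hQ.norm_exp_yosidaGenerator_le hl ht f
      · simpa using (Real.tendsto_exp_neg_atTop_nhds_zero.comp
          (tendsto_id.const_mul_atTop hm)).mul_const ‖f‖
    rw [integral_Ioi_of_hasDerivAt_of_tendsto' (fun t _ => hd t) (hint l hl _) hlim]
    simp
  have hgen : ∀ l : ℝ, 0 < l → ‖(m • f - yosidaGenerator Q l f) - (m • f - g)‖ ≤ 4 * l⁻¹ * ‖h‖ := by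
    intro l hl
    rw [sub_sub_sub_cancel_left, norm_sub_rev]
    exact hQ.norm_yosidaGenerator_sub_le hl h
  have hinv : Tendsto (fun l : ℝ => 4 * l⁻¹ * ‖h‖) atTop (𝓝 0) := by
    simpa using ((tendsto_inv_atTop_zero (𝕜 := ℝ)).const_mul 4).mul_const ‖h‖
  have hdct : Tendsto (fun l : ℝ => ∫ t in Set.Ioi (0 : ℝ), Real.exp (-(m * t)) •
      NormedSpace.exp (t • yosidaGenerator Q l) (m • f - yosidaGenerator Q l f)) atTop
      (𝓝 (∫ t in Set.Ioi (0 : ℝ), Real.exp (-(m * t)) • T t (m • f - g))) := by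
    refine tendsto_integral_filter_of_dominated_convergence
      (fun t => Real.exp (-m * t) * (‖m • f - g‖ + 4 * ‖h‖)) ?_ ?_
      ((exp_neg_integrableOn_Ioi 0 hm).mul_const _) ?_
    · exact (eventually_gt_atTop 0).mono fun l hl => (hint l hl _).aestronglyMeasurable
    · filter_upwards [eventually_ge_atTop 1] with l hl
      have hl0 : 0 < l := one_pos.trans_le hl
      filter_upwards [ae_restrict_mem measurableSet_Ioi] with t ht
      rw [norm_smul, Real.norm_of_nonneg (Real.exp_nonneg _), neg_mul]
      gcongr
      refine (hQ.norm_exp_yosidaGenerator_le hl0 (le_of_lt ht) _).trans ?_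
      have h1 := norm_add_le (m • f - g) ((m • f - yosidaGenerator Q l f) - (m • f - g))
      rw [add_sub_cancel] at h1
      refine h1.trans (add_le_add_right ((hgen l hl0).trans ?_) _)
      have : l⁻¹ ≤ 1 := inv_le_one_of_one_le₀ hl
      gcongr
      linarith
    · filter_upwards [ae_restrict_mem measurableSet_Ioi] with t ht
      refine Tendsto.const_smul ?_ _
      have h1 : Tendsto (fun l => NormedSpace.exp (t • yosidaGenerator Q l)
          ((m • f - yosidaGenerator Q l f) - (m • f - g))) atTop (𝓝 0) := by
        refine squeeze_zero_norm' ((eventually_gt_atTop 0).mono fun l hl => ?_) hinv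
        exact (hQ.norm_exp_yosidaGenerator_le hl (le_of_lt ht) _).trans (hgen l hl)
      have h2 := h1.add (hT t ht (m • f - g))
      rw [zero_add] at h2
      refine h2.congr fun l => ?_
      rw [← map_add, sub_add_cancel]
  exact tendsto_nhds_unique hdct (tendsto_const_nhds.congr' <|
    (eventually_gt_atTop 0).mono fun l hl => (hval l hl).symm)

theorem integral_eq (hT : IsYosidaLimit Q T) (hQ : IsContractivePseudoresolvent Q) {m : ℝ}
    (hm : 0 < m) (x : X) :
    Q m x = ∫ t in Set.Ioi (0 : ℝ), Real.exp (-(m * t)) • T t x := by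
  have hrange : ∀ y, Q m (Q 1 y) =
      ∫ t in Set.Ioi (0 : ℝ), Real.exp (-(m * t)) • T t (Q 1 y) := by
    intro y
    -- This vector satisfies `Q 1 (y + (1 - m) Q m y) = Q m y`, which turns the argument of `T t`
    -- into `Q 1 y`.
    have h1 := hT.integral_apply_range hQ hm (y + (1 - m) • Q m y)
    have h2 : Q 1 (y + (1 - m) • Q m y) = Q m y := by
      rw [map_add, ContinuousLinearMap.map_smul_of_tower, ← hQ.comm_apply hm one_pos,
        ← hQ.sub_eq m 1 hm one_pos, add_sub_cancel]
    rw [h2] at h1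
    rw [hQ.comm_apply hm one_pos, ← h1]
    congr with t
    congr 2
    simp only [map_sub, map_add, ContinuousLinearMap.map_smul_of_tower]
    module
  have hlip : Continuous fun x => ∫ t in Set.Ioi (0 : ℝ), Real.exp (-(m * t)) • T t x := by
    refine (LipschitzWith.of_dist_le' (K := ∫ t in Set.Ioi (0 : ℝ), Real.exp (-m * t))
      fun x y => ?_).continuous
    rw [dist_eq_norm, ← integral_sub (hT.integrableOn hQ hm x) (hT.integrableOn hQ hm y),
      ← integral_mul_const, dist_eq_norm]
    refine norm_integral_le_of_norm_le ((exp_neg_integrableOn_Ioi 0 hm).mul_const _) ?_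
    filter_upwards [ae_restrict_mem measurableSet_Ioi] with t ht
    rw [← smul_sub, ← map_sub, norm_smul, Real.norm_of_nonneg (Real.exp_nonneg _), neg_mul]
    gcongr
    exact hT.norm_le hQ ht _
  refine hQ.dense.induction
    (P := fun x => Q m x = ∫ t in Set.Ioi (0 : ℝ), Real.exp (-(m * t)) • T t x) ?_
    (isClosed_eq (Q m).continuous hlip) x
  rintro _ ⟨h, k, hk, rfl⟩
  rw [map_add, hQ.apply_eq_zero hm hk, add_zero, hrange]
  refine setIntegral_congr_fun measurableSet_Ioi fun t ht => ?_
  simp [hT.apply_of_ker hQ ht hk]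

/-- Trotter–Kato: both semigroups are compared with their Yosida exponentials at one fixed `l`,
chosen before `n`. For fixed `l` the bounded generators converge strongly. -/
theorem eventually_norm_sub_le {Qn Tn : ℕ → ℝ → X →L[ℂ] X} (hT : IsYosidaLimit Q T)
    (hQ : IsContractivePseudoresolvent Q) (hTn : ∀ n, IsYosidaLimit (Qn n) (Tn n))
    (hQn : ∀ n, IsContractivePseudoresolvent (Qn n))
    (hconv : ∀ l, 0 < l → ∀ x, Tendsto (fun n => Qn n l x) atTop (𝓝 (Q l x)))
    (hker : ∀ x, Q 1 x = 0 → ∀ n, Qn n 1 x = 0) (r : ℝ) (x : X) {ε : ℝ}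
    (hε : 0 < ε) :
    ∀ᶠ n in atTop, ∀ t ∈ Set.Ioc 0 r, ‖Tn n t x - T t x‖ ≤ ε := by
  have key : ∀ h : X, ∀ ε > 0, ∀ᶠ n in atTop, ∀ t ∈ Set.Ioc 0 r,
      ‖Tn n t (Q 1 (Q 1 h)) - T t (Q 1 (Q 1 h))‖ ≤ ε := by
    intro h ε hε
    set f := Q 1 (Q 1 h)
    have hlim : Tendsto (fun l : ℝ => r * (4 * l⁻¹ * ‖h‖)) atTop (𝓝 0) := by
      simpa using (((tendsto_inv_atTop_zero (𝕜 := ℝ)).const_mul 4).mul_const ‖h‖).const_mul r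
    obtain ⟨l, hl, hl0⟩ := ((hlim.eventually (gt_mem_nhds (show 0 < ε / 5 by positivity))).and
      (eventually_gt_atTop 0)).exists
    have hf : Tendsto (fun n => Qn n 1 (Qn n 1 h)) atTop (𝓝 f) := by
      have h1 : Tendsto (fun n => Qn n 1 (Qn n 1 h - Q 1 h)) atTop (𝓝 0) := by
        refine squeeze_zero_norm (fun n => (hQn n).norm_le 1 one_pos _) ?_
        simpa using ((hconv 1 one_pos h).sub_const (Q 1 h)).norm
      simpa using h1.add (hconv 1 one_pos (Q 1 h))
    have hgen : ∀ x, Tendsto (fun n => yosidaGenerator (Qn n) l x) atTop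
        (𝓝 (yosidaGenerator Q l x)) := by
      intro x
      simp only [yosidaGenerator_apply]
      exact ((hconv l hl0 x).const_smul _).sub_const _
    filter_upwards [hf.eventually (Metric.ball_mem_nhds f (show 0 < ε / 5 by positivity)),
      eventually_norm_exp_smul_sub_le (by positivity)
        (fun n => (hQn n).norm_yosidaGenerator_le hl0) hgen r f (show 0 < ε / 5 by positivity)]
      with n hn hexp t ht
    -- The rate for `Tn n` is available only on the range of `(Qn n 1)²`, so `f` is replaced there
    -- by the nearby `y`.
    set y := Qn n 1 (Qn n 1 h)
    rw [dist_eq_norm] at hn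
    have hrl : ∀ z : ℝ, z ≤ t * (4 * l⁻¹ * ‖h‖) → z ≤ ε / 5 := by
      intro z hz
      refine hz.trans (le_trans ?_ hl.le)
      gcongr
      exact ht.2
    have e1 := (hTn n).norm_le (hQn n) ht.1 (f - y)
    have e2 := hrl _ ((hTn n).norm_exp_sub_le (hQn n) hl0 ht.1 h)
    have e3 := (hQn n).norm_exp_yosidaGenerator_le hl0 ht.1.le (f - y)
    have e4 := hexp t ⟨ht.1.le, ht.2⟩
    have e5 := hrl _ (hT.norm_exp_sub_le hQ hl0 ht.1 h)
    rw [norm_sub_rev f y] at e1 e3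
    rw [norm_sub_rev] at e2
    set E := NormedSpace.exp (t • yosidaGenerator (Qn n) l)
    set F := NormedSpace.exp (t • yosidaGenerator Q l)
    have hdec : Tn n t f - T t f = Tn n t (f - y) + (Tn n t y - E y) - E (f - y) + (E f - F f)
        + (F f - T t f) := by
      simp only [map_sub]; abel
    rw [hdec]
    have n1 := norm_add_le (Tn n t (f - y) + (Tn n t y - E y) - E (f - y) + (E f - F f))
      (F f - T t f)
    have n2 := norm_add_le (Tn n t (f - y) + (Tn n t y - E y) - E (f - y)) (E f - F f)
    have n3 := norm_sub_le (Tn n t (f - y) + (Tn n t y - E y)) (E (f - y))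
    have n4 := norm_add_le (Tn n t (f - y)) (Tn n t y - E y)
    linarith
  -- The component `k` contributes nothing: by `hker` both semigroups annihilate it.
  obtain ⟨_, hxd, h, k, hk, rfl⟩ := Metric.dense_iff.1 hQ.dense x (ε / 3) (by positivity)
  set d := Q 1 (Q 1 h) + k
  rw [Metric.mem_ball, dist_comm, dist_eq_norm] at hxd
  filter_upwards [key h (ε / 3) (by positivity)] with n hn t ht
  have e1 := (hTn n).norm_le (hQn n) ht.1 (x - d)
  have e2 := hT.norm_le hQ ht.1 (x - d)
  have e3 := hn t ht
  have hdec : Tn n t x - T t x = Tn n t (x - d) - T t (x - d) +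
      (Tn n t (Q 1 (Q 1 h)) - T t (Q 1 (Q 1 h))) := by
    simp only [d, map_sub, map_add, (hTn n).apply_of_ker (hQn n) ht.1 (hker k hk n),
      hT.apply_of_ker hQ ht.1 hk]
    abel
  rw [hdec]
  have n1 := norm_add_le (Tn n t (x - d) - T t (x - d))
    (Tn n t (Q 1 (Q 1 h)) - T t (Q 1 (Q 1 h)))
  have n2 := norm_sub_le (Tn n t (x - d)) (T t (x - d))
  linarith

end IsYosidaLimit

end YosidaLimit

/-! ### Injectivity of the Laplace transform. -/

section LaplaceTransform

variable {X : Type*} [NormedAddCommGroup X] [NormedSpace ℝ X]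

/-- With `u = e^{-t}`, the function `g` becomes continuous on `[0, 1]` and Weierstrass approximates
it by polynomials in `e^{-t}`, against which `ψ` integrates to zero. -/
theorem integral_smul_eq_zero_of_moments_eq_zero {ψ : ℝ → X} (hψ : IntegrableOn ψ (Set.Ioi 0))
    (h : ∀ k : ℕ, ∫ t in Set.Ioi (0 : ℝ), Real.exp (-t) ^ k • ψ t = 0) {g : ℝ → ℝ}
    (hg : Continuous g) (hgs : HasCompactSupport g) (hg0 : g 0 = 0) :
    ∫ t in Set.Ioi (0 : ℝ), g t • ψ t = 0 := by
  have hG : Continuous fun u : ℝ => g (-Real.log u) := by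
    rw [continuous_iff_continuousAt]
    intro u
    -- At `u = 0` the convention `Real.log 0 = 0` gives the value `g 0 = 0`, which agrees with the
    -- limit of `g` at infinity.
    rcases eq_or_ne u 0 with rfl | hu
    · rw [continuousAt_iff_punctured_nhds]
      have h1 : Tendsto g atTop (𝓝 0) := by
        rw [hasCompactSupport_iff_eventuallyEq, Filter.coclosedCompact_eq_cocompact] at hgs
        exact (hgs.filter_mono atTop_le_cocompact).tendsto
      simpa [hg0, Function.comp_def] using h1.comp (tendsto_neg_atBot_atTop.comp Real.tendsto_log_nhdsNE_zero)
    · exact hg.continuousAt.comp (Real.continuousAt_log hu).neg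
  have hexp : ∀ t ∈ Set.Ioi (0 : ℝ), Real.exp (-t) ∈ Set.Icc (0 : ℝ) 1 := fun t ht =>
    ⟨(Real.exp_pos _).le, Real.exp_le_one_iff.2 (neg_nonpos.2 (le_of_lt ht))⟩
  have hpow : ∀ k : ℕ, IntegrableOn (fun t => Real.exp (-t) ^ k • ψ t) (Set.Ioi 0) := by
    intro k
    refine Integrable.bdd_smul hψ 1 ?_ ?_
    · exact Continuous.aestronglyMeasurable (by fun_prop)
    · filter_upwards [ae_restrict_mem measurableSet_Ioi] with t ht
      rw [norm_pow, Real.norm_of_nonneg (Real.exp_nonneg _)]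
      exact pow_le_one₀ (hexp t ht).1 (hexp t ht).2
  have hpoly : ∀ p : Polynomial ℝ,
      IntegrableOn (fun t => p.eval (Real.exp (-t)) • ψ t) (Set.Ioi 0) ∧
      ∫ t in Set.Ioi (0 : ℝ), p.eval (Real.exp (-t)) • ψ t = 0 := by
    intro p
    have he : (fun t => p.eval (Real.exp (-t)) • ψ t) = fun t =>
        ∑ k ∈ p.support, p.coeff k • (Real.exp (-t) ^ k • ψ t) := by
      ext t
      rw [Polynomial.eval_eq_sum, Polynomial.sum, Finset.sum_smul]
      simp_rw [smul_smul]
    rw [he]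
    have hk : ∀ k ∈ p.support, IntegrableOn
        (fun t => p.coeff k • (Real.exp (-t) ^ k • ψ t)) (Set.Ioi 0) :=
      fun k _ => (hpow k).smul _
    refine ⟨integrable_finsetSum _ hk, ?_⟩
    rw [integral_finsetSum _ hk]
    refine Finset.sum_eq_zero fun k _ => ?_
    rw [integral_smul, h k, smul_zero]
  have hgint : IntegrableOn (fun t => g t • ψ t) (Set.Ioi 0) := by
    obtain ⟨C, hC⟩ := hgs.exists_bound_of_continuous hg
    exact Integrable.bdd_smul hψ C hg.aestronglyMeasurable (Eventually.of_forall hC)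
  rw [← norm_eq_zero]
  refine le_antisymm (le_of_forall_pos_le_add fun ε hε => ?_) (norm_nonneg _)
  set K := ∫ t in Set.Ioi (0 : ℝ), ‖ψ t‖
  have hK : 0 ≤ K := integral_nonneg fun _ => norm_nonneg _
  obtain ⟨p, hp⟩ := exists_polynomial_near_of_continuousOn 0 1 _ hG.continuousOn (ε / (K + 1))
    (by positivity)
  have h1 : ∫ t in Set.Ioi (0 : ℝ), g t • ψ t =
      ∫ t in Set.Ioi (0 : ℝ), (g t - p.eval (Real.exp (-t))) • ψ t := by
    simp_rw [sub_smul]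
    rw [integral_sub hgint (hpoly p).1, (hpoly p).2, sub_zero]
  rw [h1, zero_add]
  calc _ ≤ ∫ t in Set.Ioi (0 : ℝ), ε / (K + 1) * ‖ψ t‖ := by
        refine norm_integral_le_of_norm_le (hψ.norm.const_mul _) ?_
        filter_upwards [ae_restrict_mem measurableSet_Ioi] with t ht
        rw [norm_smul, Real.norm_eq_abs, abs_sub_comm]
        gcongr
        simpa using (hp _ (hexp t ht)).le
    _ = ε / (K + 1) * K := integral_const_mul _ _
    _ ≤ ε / (K + 1) * (K + 1) := by gcongr; linarith
    _ = ε := by field_simp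

variable [CompleteSpace X]

/-- The transform at `w + 1 + k` is the `k`-th moment, in the variable `e^{-t}`, of `e^{-(w+1)t}
φ(t)`. -/
theorem eqOn_zero_of_laplace_eq_zero {φ : ℝ → X} (hφ : ContinuousOn φ (Set.Ioi 0)) {w : ℝ}
    (hint : ∀ l, w < l → IntegrableOn (fun t => Real.exp (-(l * t)) • φ t) (Set.Ioi 0))
    (h : ∀ l, w < l → ∫ t in Set.Ioi (0 : ℝ), Real.exp (-(l * t)) • φ t = 0) :
    Set.EqOn φ 0 (Set.Ioi 0) := by
  set ψ : ℝ → X := fun t => Real.exp (-((w + 1) * t)) • φ t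
  have hψ : IntegrableOn ψ (Set.Ioi 0) := hint _ (lt_add_one w)
  have hmom : ∀ k : ℕ, ∫ t in Set.Ioi (0 : ℝ), Real.exp (-t) ^ k • ψ t = 0 := by
    intro k
    rw [← h (w + 1 + k) (by linarith [k.cast_nonneg (α := ℝ)])]
    congr with t
    rw [smul_smul, ← Real.exp_nat_mul, ← Real.exp_add]
    congr 2
    ring
  have hae : ∀ᵐ t, t ∈ Set.Ioi (0 : ℝ) → ψ t = 0 := by
    refine isOpen_Ioi.ae_eq_zero_of_integral_contDiff_smul_eq_zero hψ.locallyIntegrableOn ?_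
    intro g hg hgs hsupp
    have hg0 : ∀ t, t ∉ Set.Ioi (0 : ℝ) → g t = 0 := fun t ht =>
      image_eq_zero_of_notMem_tsupport fun h' => ht (hsupp h')
    rw [← setIntegral_eq_integral_of_forall_compl_eq_zero (s := Set.Ioi 0)
      fun t ht => by rw [hg0 t ht, zero_smul]]
    exact integral_smul_eq_zero_of_moments_eq_zero hψ hmom hg.continuous hgs
      (hg0 0 (by simp))
  have hae' : φ =ᵐ[volume.restrict (Set.Ioi 0)] 0 := by
    filter_upwards [(ae_restrict_iff' measurableSet_Ioi).2 hae] with t ht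
    exact (smul_eq_zero.1 ht).resolve_left (Real.exp_pos _).ne'
  exact Measure.eqOn_open_of_ae_eq hae' isOpen_Ioi hφ continuousOn_const

end LaplaceTransform

/-! ### Uniqueness of the generated semigroup. -/

section Uniqueness

variable {X : Type*} [NormedAddCommGroup X] [NormedSpace ℂ X] [CompleteSpace X]

theorem IsSemigroupGeneratedByNeg.eqOn {A : Submodule ℂ (X × X)} {S S' : ℝ → X →L[ℂ] X}
    (hS : IsSemigroupGeneratedByNeg A S) (hS' : IsSemigroupGeneratedByNeg A S') :
    Set.EqOn S S' (Set.Ioi 0) := by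
  obtain ⟨hdeg, w, hw⟩ := hS
  obtain ⟨hdeg', w', hw'⟩ := hS'
  intro t ht
  ext x
  have key : ∀ l, max w w' < l →
      IntegrableOn (fun t => Real.exp (-(l * t)) • (S t x - S' t x)) (Set.Ioi 0) ∧
      ∫ t in Set.Ioi (0 : ℝ), Real.exp (-(l * t)) • (S t x - S' t x) = 0 := by
    intro l hl
    obtain ⟨R, hR, hRS⟩ := hw l ((le_max_left _ _).trans_lt hl)
    obtain ⟨R', hR', hRS'⟩ := hw' l ((le_max_right _ _).trans_lt hl)
    have hRR : R x = R' x := ((hR' _ _).1 ((hR _ _).2 rfl)).symm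
    simp_rw [smul_sub]
    refine ⟨(hRS x).1.sub (hRS' x).1, ?_⟩
    rw [integral_sub (hRS x).1 (hRS' x).1, ← (hRS x).2, ← (hRS' x).2, hRR, sub_self]
  exact sub_eq_zero.1 <| eqOn_zero_of_laplace_eq_zero
    ((hdeg.strongly_continuous x).sub (hdeg'.strongly_continuous x))
    (fun l hl => (key l hl).1) (fun l hl => (key l hl).2) ht

end Uniqueness

/-! ### Boundedness and coercivity of closed sectorial forms. -/

section SectorialBounds

/-- Both inequalities are closed conditions, so the open sector suffices; there the second one is
`‖w‖ sin (θ - |arg w|) ≥ 0`. -/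
theorem mem_closure_openSector {θ : ℝ} (hθ : θ ∈ Set.Ioo 0 (Real.pi / 2)) {z : ℂ}
    (hz : z ∈ closure (openSector θ)) : 0 ≤ z.re ∧ |z.im| * Real.cos θ ≤ Real.sin θ * z.re := by
  have hclosed : IsClosed {z : ℂ | 0 ≤ z.re ∧ |z.im| * Real.cos θ ≤ Real.sin θ * z.re} :=
    (isClosed_le continuous_const Complex.continuous_re).inter
      (isClosed_le (f := fun z : ℂ => |z.im| * Real.cos θ) (g := fun z => Real.sin θ * z.re)
        (by fun_prop) (by fun_prop))
  refine closure_minimal (fun w hw => ?_) hclosed hz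
  obtain ⟨hw0, hw⟩ := hw
  have hre : w.re = ‖w‖ * Real.cos |w.arg| := by rw [Real.cos_abs, Complex.norm_mul_cos_arg]
  have him : |w.im| = ‖w‖ * Real.sin |w.arg| := by
    rw [← Complex.norm_mul_sin_arg w, abs_mul, abs_norm]
    congr 1
    exact Real.abs_sin_eq_sin_abs_of_abs_le_pi (by linarith [hθ.2, Real.pi_pos])
  have h1 : 0 ≤ Real.sin (θ - |w.arg|) :=
    Real.sin_nonneg_of_nonneg_of_le_pi (by linarith) (by linarith [hθ.2, abs_nonneg w.arg,
      Real.pi_pos])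
  rw [Real.sin_sub] at h1
  refine ⟨?_, ?_⟩
  · rw [hre]
    exact mul_nonneg (norm_nonneg _) (Real.cos_nonneg_of_mem_Icc
      ⟨by linarith [abs_nonneg w.arg, Real.pi_pos], by linarith [hθ.2]⟩)
  · rw [hre, him]
    nlinarith [norm_nonneg w]

variable {V : Type*} [NormedAddCommGroup V] [InnerProductSpace ℂ V]

/-- Polarization and the parallelogram law give `K (‖u‖² + ‖v‖²)`; normalizing both vectors gives
the product. -/
theorem norm_sesquilin_le_of_norm_diag_le {a : V →ₗ[ℂ] V →ₗ⋆[ℂ] ℂ} {K : ℝ}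
    (h : ∀ u, ‖a u u‖ ≤ K * ‖u‖ ^ 2) (u v : V) : ‖a u v‖ ≤ (2 * K) * ‖u‖ * ‖v‖ := by
  have h1 : ∀ u v, ‖a u v‖ ≤ K * (‖u‖ ^ 2 + ‖v‖ ^ 2) := by
    intro u v
    have hpol : 4 * a u v = a (u + v) (u + v) - a (u - v) (u - v)
        + Complex.I * a (u + Complex.I • v) (u + Complex.I • v)
        - Complex.I * a (u - Complex.I • v) (u - Complex.I • v) := by
      simp only [map_add, map_sub, LinearMap.add_apply, LinearMap.sub_apply, map_smul,
        LinearMap.smul_apply, LinearMap.map_smulₛₗ, smul_eq_mul, Complex.conj_I]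
      linear_combination (2 * a u v - 2 * a v u) * Complex.I_sq
    have n1 := norm_sub_le (a (u + v) (u + v) - a (u - v) (u - v)
        + Complex.I * a (u + Complex.I • v) (u + Complex.I • v))
        (Complex.I * a (u - Complex.I • v) (u - Complex.I • v))
    have n2 := norm_add_le (a (u + v) (u + v) - a (u - v) (u - v))
        (Complex.I * a (u + Complex.I • v) (u + Complex.I • v))
    have n3 := norm_sub_le (a (u + v) (u + v)) (a (u - v) (u - v))
    rw [← hpol] at n1
    simp only [norm_mul, Complex.norm_I, one_mul, Complex.norm_ofNat] at n1 n2
    have p1 := parallelogram_law_with_norm ℂ u v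
    have p2 := parallelogram_law_with_norm ℂ u (Complex.I • v)
    rw [norm_smul, Complex.norm_I, one_mul] at p2
    have k1 := h (u + v)
    have k2 := h (u - v)
    have k3 := h (u + Complex.I • v)
    have k4 := h (u - Complex.I • v)
    have : 4 * ‖a u v‖ ≤ K * ((‖u + v‖ ^ 2 + ‖u - v‖ ^ 2) +
        (‖u + Complex.I • v‖ ^ 2 + ‖u - Complex.I • v‖ ^ 2)) := by
      linarith
    rw [p1, p2] at this
    linarith
  rcases eq_or_ne u 0 with rfl | hu
  · simp
  rcases eq_or_ne v 0 with rfl | hv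
  · simp
  have hu' := norm_pos_iff.2 hu
  have hv' := norm_pos_iff.2 hv
  have h2 := h1 (((‖u‖⁻¹ : ℝ) : ℂ) • u) (((‖v‖⁻¹ : ℝ) : ℂ) • v)
  simp only [map_smul, LinearMap.smul_apply, LinearMap.map_smulₛₗ, norm_smul, Complex.conj_ofReal,
    Complex.norm_real, norm_inv, norm_norm, smul_eq_mul, norm_mul] at h2
  rw [inv_mul_cancel₀ hu'.ne', inv_mul_cancel₀ hv'.ne'] at h2
  calc ‖a u v‖ = ‖u‖ * ‖v‖ * (‖u‖⁻¹ * (‖v‖⁻¹ * ‖a u v‖)) := by field_simp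
    _ ≤ ‖u‖ * ‖v‖ * (K * (1 ^ 2 + 1 ^ 2)) := by
        refine mul_le_mul_of_nonneg_left ?_ (by positivity)
        linarith
    _ = _ := by ring

variable {H : Type*} [NormedAddCommGroup H] [InnerProductSpace ℂ H]

/-- Both complete norms dominate that of `H` through the injective `j`, so the closed graph theorem
makes `e` continuous and the open mapping theorem inverts it. The copy `W` of `V` keeps the form
norm apart from the given norm of `V`. -/
theorem exists_norm_equiv_of_linearEquiv [CompleteSpace V] {W : Type*} [AddCommGroup W]
    [Module ℂ W] (e : V ≃ₗ[ℂ] W) (j : V →L[ℂ] H) (hj : Function.Injective j) {b : W → W → ℂ}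
    (hb : IsCompleteInnerProduct b) {c : ℝ} (hc : 0 < c)
    (hjb : ∀ u, c * ‖j u‖ ^ 2 ≤ (b (e u) (e u)).re) :
    ∃ α > 0, ∃ C, ∀ u, α * ‖u‖ ^ 2 ≤ (b (e u) (e u)).re ∧ (b (e u) (e u)).re ≤ C * ‖u‖ ^ 2 := by
  have hzero : b 0 0 = 0 := by simpa using hb.smul_left 0 0 0
  let core : InnerProductSpace.Core ℂ W :=
    { inner := fun x y => b y x
      conj_inner_symm := fun x y => hb.conj_symm y x
      re_inner_nonneg := fun x => by
        rcases eq_or_ne x 0 with rfl | hx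
        · simp [hzero]
        · exact (hb.pos x hx).le
      add_left := fun x y z => by
        rw [← hb.conj_symm, hb.add_left, map_add, hb.conj_symm, hb.conj_symm]
      smul_left := fun x y r => by
        rw [← hb.conj_symm, hb.smul_left, map_mul, hb.conj_symm]
      definite := fun x hx => by
        by_contra hne
        have := hb.pos x hne
        rw [hx] at this
        simp at this }
  let : NormedAddCommGroup W := core.toNormedAddCommGroup
  let : InnerProductSpace ℂ W := InnerProductSpace.ofCore core.toCore
  have hnorm : ∀ x : W, ‖x‖ = √(b x x).re := fun x => norm_eq_sqrt_re_inner (𝕜 := ℂ) x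
  have hnn : ∀ x : W, 0 ≤ (b x x).re := fun x => core.re_inner_nonneg x
  have hsq : ∀ x : W, ‖x‖ ^ 2 = (b x x).re := fun x => by rw [hnorm, Real.sq_sqrt (hnn x)]
  have : CompleteSpace W := by
    refine Metric.complete_of_cauchySeq_tendsto fun x hx => ?_
    obtain ⟨u, hu⟩ := hb.complete x fun ε hε => by
      obtain ⟨N, hN⟩ := Metric.cauchySeq_iff.1 hx ε hε
      exact ⟨N, fun m hm n hn => by rw [← hnorm, ← dist_eq_norm]; exact hN m hm n hn⟩
    refine ⟨u, tendsto_iff_norm_sub_tendsto_zero.2 ?_⟩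
    simpa only [hnorm] using hu
  have hcont : Continuous e := by
    refine LinearMap.continuous_of_seq_closed_graph (g := e.toLinearMap) fun u x y hu hy => ?_
    have h1 : Tendsto (fun n => j (u n)) atTop (𝓝 (j (e.symm y))) := by
      rw [tendsto_iff_norm_sub_tendsto_zero]
      refine squeeze_zero (fun _ => norm_nonneg _) (g := fun n => √(c⁻¹) * ‖e (u n) - y‖)
        (fun n => ?_) ?_
      · rw [← map_sub]
        have := hjb (u n - e.symm y)
        rw [← hsq, map_sub e, e.apply_symm_apply] at this
        rw [← Real.sqrt_sq (norm_nonneg (e (u n) - y)), ← Real.sqrt_mul (by positivity)]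
        refine Real.le_sqrt_of_sq_le ?_
        rw [inv_mul_eq_div, le_div_iff₀ hc, mul_comm]
        exact this
      · simpa using (tendsto_iff_norm_sub_tendsto_zero.1 hy).const_mul (√(c⁻¹))
    have h2 := tendsto_nhds_unique h1 ((j.continuous.tendsto x).comp hu)
    have h3 := hj h2
    rw [← h3]
    simp
  let E := e.toContinuousLinearEquivOfContinuous hcont
  have hE : ∀ u, E u = e u := fun _ => rfl
  refine ⟨(‖(E.symm : W →L[ℂ] V)‖ ^ 2 + 1)⁻¹, by positivity, ‖(E : V →L[ℂ] W)‖ ^ 2, fun u => ?_⟩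
  rw [← hsq]
  constructor
  · rw [inv_mul_le_iff₀ (by positivity)]
    have h1 := (E.symm : W →L[ℂ] V).le_opNorm (e u)
    have h2 : (E.symm : W →L[ℂ] V) (e u) = u := E.symm_apply_apply u
    rw [h2] at h1
    calc ‖u‖ ^ 2 ≤ (‖(E.symm : W →L[ℂ] V)‖ * ‖e u‖) ^ 2 := by gcongr
      _ = ‖(E.symm : W →L[ℂ] V)‖ ^ 2 * ‖e u‖ ^ 2 := mul_pow _ _ _
      _ ≤ _ := by gcongr; linarith
  · rw [← mul_pow]
    have h1 := (E : V →L[ℂ] W).le_opNorm u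
    gcongr
    exact h1

/-- Coercivity is the norm equivalence. For boundedness, the sector controls `|Im a(u, u)|` by `tan
θ` times the shifted real part, and polarization passes from the diagonal to all pairs. -/
theorem IsClosedForm.exists_bounds [CompleteSpace V] {j : V →L[ℂ] H}
    (hj : Function.Injective j) {a : V →ₗ[ℂ] V →ₗ⋆[ℂ] ℂ}
    (ha : IsClosedForm (j : V →ₗ[ℂ] H) a) :
    ∃ w α M : ℝ, 0 < α ∧ (∀ u, α * ‖u‖ ^ 2 ≤ (a u u).re + w * ‖j u‖ ^ 2) ∧
      ∀ u v, ‖a u v‖ ≤ M * ‖u‖ * ‖v‖ := by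
  obtain ⟨γ, w, ⟨θ, hθ, hsec⟩, hw, hb⟩ := ha
  have hcos : 0 < Real.cos θ := Real.cos_pos_of_mem_Ioo ⟨by linarith [hθ.1, Real.pi_pos], hθ.2⟩
  have hsin : 0 < Real.sin θ := Real.sin_pos_of_pos_of_lt_pi hθ.1 (by linarith [hθ.2, Real.pi_pos])
  have hval : ∀ u, (formRealPart a u u +
      (w : ℂ) * inner ℂ ((j : V →ₗ[ℂ] H) u) ((j : V →ₗ[ℂ] H) u)).re =
      (a u u).re + w * ‖j u‖ ^ 2 := by
    intro u
    simp only [formRealPart, ContinuousLinearMap.coe_coe, inner_self_eq_norm_sq_to_K]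
    simp [← Complex.ofReal_pow]
    ring
  have hs : ∀ u, 0 ≤ (a u u).re - γ * ‖j u‖ ^ 2 ∧
      |(a u u).im| * Real.cos θ ≤ Real.sin θ * ((a u u).re - γ * ‖j u‖ ^ 2) := by
    intro u
    have := mem_closure_openSector hθ (hsec u)
    simpa [← Complex.ofReal_pow] using this
  obtain ⟨α, hα, C, hC⟩ := exists_norm_equiv_of_linearEquiv (LinearEquiv.refl ℂ V) j hj hb
    (c := γ + w) (by linarith) (fun u => by
      simp only [LinearEquiv.refl_apply]
      rw [hval]
      linarith [(hs u).1])
  simp only [LinearEquiv.refl_apply, hval] at hC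
  refine ⟨w, α, 2 * ((C + |w| * ‖j‖ ^ 2) + Real.sin θ / Real.cos θ * C), hα, fun u => (hC u).1,
    norm_sesquilin_le_of_norm_diag_le fun u => ?_⟩
  have hju : ‖j u‖ ^ 2 ≤ ‖j‖ ^ 2 * ‖u‖ ^ 2 := by
    rw [← mul_pow]
    gcongr
    exact j.le_opNorm u
  have hwj : |w * ‖j u‖ ^ 2| ≤ |w| * ‖j‖ ^ 2 * ‖u‖ ^ 2 := by
    rw [abs_mul, abs_of_nonneg (by positivity : 0 ≤ ‖j u‖ ^ 2), mul_assoc]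
    gcongr
  have hb0 : 0 ≤ (a u u).re + w * ‖j u‖ ^ 2 := le_trans (by positivity) (hC u).1
  have hre : |(a u u).re| ≤ (C + |w| * ‖j‖ ^ 2) * ‖u‖ ^ 2 := by
    have h1 := (hC u).2
    have h2 := abs_le.1 hwj
    rw [abs_le]
    constructor <;> nlinarith
  have him : |(a u u).im| ≤ Real.sin θ / Real.cos θ * C * ‖u‖ ^ 2 := by
    have h1 := (hs u).2
    rw [div_mul_eq_mul_div, div_mul_eq_mul_div, le_div_iff₀ hcos, mul_assoc]
    refine h1.trans ?_
    gcongr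
    have h3 : 0 ≤ (γ + w) * ‖j u‖ ^ 2 := mul_nonneg (by linarith) (by positivity)
    linarith [(hC u).2]
  calc ‖a u u‖ ≤ |(a u u).re| + |(a u u).im| := Complex.norm_le_abs_re_add_abs_im _
    _ ≤ _ := by linarith

end SectorialBounds

/-! ### Coercive operators and representation of bounded forms. -/

section LaxMilgram

variable {V : Type*} [NormedAddCommGroup V] [InnerProductSpace ℂ V]

theorem norm_le_of_coercive {L : V →L[ℂ] V} {α : ℝ}
    (h : ∀ u, α * ‖u‖ ^ 2 ≤ (inner ℂ u (L u)).re) (u : V) : α * ‖u‖ ≤ ‖L u‖ := by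
  rcases eq_or_ne u 0 with rfl | hu
  · simp
  have h1 : (inner ℂ u (L u)).re ≤ ‖u‖ * ‖L u‖ := re_inner_le_norm (𝕜 := ℂ) u (L u)
  have h2 := h u
  have h3 := norm_pos_iff.2 hu
  refine le_of_mul_le_mul_left ?_ h3
  linarith

variable [CompleteSpace V]

/-- The Lax–Milgram theorem. -/
theorem isInvertible_of_coercive {L : V →L[ℂ] V} {α : ℝ} (hα : 0 < α)
    (h : ∀ u, α * ‖u‖ ^ 2 ≤ (inner ℂ u (L u)).re) : L.IsInvertible := by
  have hanti : AntilipschitzWith (α⁻¹).toNNReal L := by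
    refine L.antilipschitz_of_bound fun u => ?_
    rw [Real.coe_toNNReal _ (by positivity), inv_mul_eq_div, le_div_iff₀ hα, mul_comm]
    exact norm_le_of_coercive h u
  have hker : L.ker = ⊥ := LinearMap.ker_eq_bot.2 hanti.injective
  have hclosed : IsClosed (L.range : Set V) := hanti.isClosed_range L.uniformContinuous
  have hrange : L.range = ⊤ := by
    have := hclosed.completeSpace_coe
    rw [← L.range.orthogonal_orthogonal, Submodule.eq_top_iff']
    intro v w hw
    have h1 := hw (L w) ⟨w, rfl⟩
    have h2 := h w
    rw [← inner_conj_symm, h1] at h2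
    have h3 : ‖w‖ ^ 2 ≤ 0 := by
      simp only [map_zero, Complex.zero_re] at h2
      nlinarith
    have h4 : w = 0 := by simpa using le_antisymm h3 (by positivity)
    rw [h4]
    exact inner_zero_left _
  exact ⟨ContinuousLinearEquiv.ofBijective L hker hrange, rfl⟩

theorem exists_inner_eq_sesquilin {a : V →ₗ[ℂ] V →ₗ⋆[ℂ] ℂ} {M : ℝ}
    (ha : ∀ u v, ‖a u v‖ ≤ M * ‖u‖ * ‖v‖) :
    ∃ L : V →L[ℂ] V, ∀ u v, a u v = inner ℂ v (L u) := by
  have h : ∀ u, ∃ f : V, ∀ v, a u v = inner ℂ v f := by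
    intro u
    let φ : V →ₗ[ℂ] ℂ :=
      { toFun := fun v => conj (a u v)
        map_add' := fun x y => by simp
        map_smul' := fun c x => by simp }
    let ψ : V →L[ℂ] ℂ := φ.mkContinuous (M * ‖u‖) fun v => by
      simpa [φ] using ha u v
    refine ⟨(InnerProductSpace.toDual ℂ V).symm ψ, fun v => ?_⟩
    rw [← inner_conj_symm, InnerProductSpace.toDual_symm_apply]
    simp [ψ, φ]
  choose L hL using h
  let L' : V →ₗ[ℂ] V :=
    { toFun := L
      map_add' := fun x y => ext_inner_left ℂ fun v => by
        rw [← hL, inner_add_right, ← hL, ← hL, map_add, LinearMap.add_apply]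
      map_smul' := fun c x => ext_inner_left ℂ fun v => by
        rw [← hL, RingHom.id_apply, inner_smul_right, ← hL, map_smul, LinearMap.smul_apply,
          smul_eq_mul] }
  refine ⟨L'.mkContinuous M fun u => ?_, hL⟩
  change ‖L u‖ ≤ M * ‖u‖
  rcases eq_or_ne (L u) 0 with h0 | h0
  · rw [h0, norm_zero]
    rcases eq_or_ne u 0 with rfl | hu
    · simp
    have h1 := (norm_nonneg _).trans (ha u u)
    exact nonneg_of_mul_nonneg_left h1 (norm_pos_iff.2 hu)
  · have h1 := ha u (L u)
    rw [hL, inner_self_eq_norm_sq_to_K] at h1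
    have h2 := norm_pos_iff.2 h0
    refine le_of_mul_le_mul_right ?_ h2
    simpa [sq] using h1

end LaxMilgram

/-! ### The pseudo-resolvent of a coercive form. -/

section FormResolvent

open ContinuousLinearMap (adjoint)

variable {V : Type*} [NormedAddCommGroup V] [InnerProductSpace ℂ V] [CompleteSpace V]
variable {H : Type*} [NormedAddCommGroup H] [InnerProductSpace ℂ H] [CompleteSpace H]

/-- The operator on `V` which represents the form `(L u, v)_V + l (j u, j v)_H`. -/
noncomputable def shiftedOperator (j : V →L[ℂ] H) (L : V →L[ℂ] V) (l : ℝ) : V →L[ℂ] V :=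
  L + (l : ℂ) • (adjoint j ∘L j)

/-- The map taking `f` to the solution `u` of `(L u, v)_V + l (j u, j v)_H = (f, j v)_H`. -/
noncomputable def formSolution (j : V →L[ℂ] H) (L : V →L[ℂ] V) (l : ℝ) : H →L[ℂ] V :=
  (shiftedOperator j L l).inverse ∘L adjoint j

/-- The resolvent in `H` of the form represented by `L`. -/
noncomputable def formResolvent (j : V →L[ℂ] H) (L : V →L[ℂ] V) (l : ℝ) : H →L[ℂ] H :=
  j ∘L formSolution j L l

variable {j : V →L[ℂ] H} {L : V →L[ℂ] V} {α l : ℝ}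

theorem shiftedOperator_apply (u : V) :
    shiftedOperator j L l u = L u + (l : ℂ) • adjoint j (j u) := rfl

theorem formResolvent_apply (f : H) : formResolvent j L l f = j (formSolution j L l f) := rfl

theorem re_inner_shiftedOperator (u : V) : (inner ℂ u (shiftedOperator j L l u)).re =
    (inner ℂ u (L u)).re + l * ‖j u‖ ^ 2 := by
  rw [shiftedOperator_apply, inner_add_right, inner_smul_right,
    ContinuousLinearMap.adjoint_inner_right, inner_self_eq_norm_sq_to_K]
  simp [← Complex.ofReal_pow]

theorem coercive_shiftedOperator (hL : ∀ u, α * ‖u‖ ^ 2 ≤ (inner ℂ u (L u)).re)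
    (hl : 0 < l) (u : V) : α * ‖u‖ ^ 2 ≤ (inner ℂ u (shiftedOperator j L l u)).re := by
  rw [re_inner_shiftedOperator]
  exact (hL u).trans (le_add_of_nonneg_right (by positivity))

theorem shiftedOperator_formSolution (hα : 0 < α)
    (hL : ∀ u, α * ‖u‖ ^ 2 ≤ (inner ℂ u (L u)).re) (hl : 0 < l) (f : H) :
    shiftedOperator j L l (formSolution j L l f) = adjoint j f :=
  (isInvertible_of_coercive hα (coercive_shiftedOperator hL hl)).self_apply_inverse _

theorem eq_formSolution (hα : 0 < α)
    (hL : ∀ u, α * ‖u‖ ^ 2 ≤ (inner ℂ u (L u)).re) (hl : 0 < l) {u : V} {f : H}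
    (h : shiftedOperator j L l u = adjoint j f) : u = formSolution j L l f := by
  rw [formSolution, ContinuousLinearMap.comp_apply, ← h]
  exact ((isInvertible_of_coercive hα (coercive_shiftedOperator hL hl)).inverse_apply_self _).symm

/-- Testing the equation with its solution `u` gives `l ‖j u‖² ≤ Re (f, j u)`. -/
theorem norm_formResolvent_le (hα : 0 < α)
    (hL : ∀ u, α * ‖u‖ ^ 2 ≤ (inner ℂ u (L u)).re) (hl : 0 < l) (f : H) :
    ‖formResolvent j L l f‖ ≤ l⁻¹ * ‖f‖ := by
  set u := formSolution j L l f
  have h1 := re_inner_shiftedOperator (j := j) (L := L) (l := l) u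
  rw [shiftedOperator_formSolution hα hL hl, ContinuousLinearMap.adjoint_inner_right] at h1
  have h2 : (inner ℂ (j u) f).re ≤ ‖j u‖ * ‖f‖ := re_inner_le_norm (𝕜 := ℂ) (j u) f
  have h3 : 0 ≤ (inner ℂ u (L u)).re := le_trans (by positivity) (hL u)
  rw [formResolvent_apply, inv_mul_eq_div, le_div_iff₀ hl]
  rcases eq_or_ne (j u) 0 with h0 | h0
  · rw [h0]; simp
  · refine le_of_mul_le_mul_left ?_ (norm_pos_iff.2 h0)
    nlinarith

theorem formSolution_sub (hα : 0 < α)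
    (hL : ∀ u, α * ‖u‖ ^ 2 ≤ (inner ℂ u (L u)).re) {m : ℝ} (hl : 0 < l) (hm : 0 < m) (f : H) :
    formSolution j L l f - formSolution j L m f =
      formSolution j L l (((m - l : ℝ) : ℂ) • formResolvent j L m f) := by
  refine eq_formSolution hα hL hl ?_
  have h1 := shiftedOperator_formSolution (j := j) hα hL hl f
  have h2 := shiftedOperator_formSolution (j := j) hα hL hm f
  rw [map_sub, h1, ← h2, map_smul, formResolvent_apply]
  simp only [shiftedOperator_apply]
  push_cast
  module

theorem formResolvent_sub (hα : 0 < α)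
    (hL : ∀ u, α * ‖u‖ ^ 2 ≤ (inner ℂ u (L u)).re) {m : ℝ} (hl : 0 < l) (hm : 0 < m) (f : H) :
    formResolvent j L l f - formResolvent j L m f =
      (m - l) • formResolvent j L l (formResolvent j L m f) := by
  rw [formResolvent_apply, formResolvent_apply (l := m), ← map_sub, formSolution_sub hα hL hl hm,
    map_smul, map_smul, ← formResolvent_apply, Complex.coe_smul, formResolvent_apply (l := m)]

/-- The kernel is `(ran j)^⊥`, whatever `l` and `L` are; this makes the kernels of restricted forms
comparable. -/
theorem formResolvent_eq_zero_iff (hj : Function.Injective j) (hα : 0 < α)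
    (hL : ∀ u, α * ‖u‖ ^ 2 ≤ (inner ℂ u (L u)).re) (hl : 0 < l) {f : H} :
    formResolvent j L l f = 0 ↔ adjoint j f = 0 := by
  constructor
  · intro h
    rw [formResolvent_apply, map_eq_zero_iff j hj] at h
    rw [← shiftedOperator_formSolution hα hL hl, h, map_zero]
  · intro h
    rw [formResolvent_apply, formSolution, ContinuousLinearMap.comp_apply, h, map_zero, map_zero]

/-- The error `d` solves `(L + l j*j) d = -L u`. Testing with `d` bounds `α ‖d‖² + l ‖j d‖²` by `‖L
u‖ ‖d‖`, and Young's inequality absorbs `‖d‖`. -/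
theorem norm_smul_formResolvent_sub_le (hα : 0 < α)
    (hL : ∀ u, α * ‖u‖ ^ 2 ≤ (inner ℂ u (L u)).re) (hl : 0 < l) (u : V) :
    ‖l • formResolvent j L l (j u) - j u‖ ^ 2 ≤ ‖L u‖ ^ 2 / α * l⁻¹ := by
  set d := (l : ℂ) • formSolution j L l (j u) - u
  have h1 : shiftedOperator j L l d = -(L u) := by
    rw [map_sub, map_smul, shiftedOperator_formSolution hα hL hl, shiftedOperator_apply]
    abel
  have h2 := re_inner_shiftedOperator (j := j) (L := L) (l := l) d
  have h3 := re_inner_le_norm (𝕜 := ℂ) d (-(L u))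
  rw [norm_neg] at h3
  change (inner ℂ d (-(L u))).re ≤ _ at h3
  rw [h1] at h2
  have h4 := hL d
  have h5 : j d = l • formResolvent j L l (j u) - j u := by
    rw [map_sub, map_smul, ← formResolvent_apply, Complex.coe_smul]
  rw [← h5, ← div_eq_mul_inv, div_div, le_div_iff₀ (by positivity)]
  nlinarith [sq_nonneg (‖L u‖ - 2 * α * ‖d‖), sq_nonneg (α * ‖d‖), sq_nonneg (‖L u‖)]

theorem isContractivePseudoresolvent_formResolvent (hj : Function.Injective j) (hα : 0 < α)
    (hL : ∀ u, α * ‖u‖ ^ 2 ≤ (inner ℂ u (L u)).re) :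
    IsContractivePseudoresolvent (formResolvent j L) where
  sub_eq l m hl hm x := formResolvent_sub hα hL hl hm x
  norm_le l hl x := norm_formResolvent_le hα hL hl x
  dense := by
    set Q := formResolvent j L
    have hQ1 : ∀ l, 0 < l → ∀ y, Q l y = Q 1 (y + (1 - l) • Q l y) := by
      intro l hl y
      have h1 : Q 1 y - Q l y = (l - 1) • Q 1 (Q l y) := formResolvent_sub hα hL one_pos hl y
      rw [map_add, ContinuousLinearMap.map_smul_of_tower]
      linear_combination (norm := module) (-1 : ℝ) • h1
    rw [Metric.dense_iff]
    intro x ε hε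
    -- The part of `x` orthogonal to `ran j` lies in `ker Q 1`; the other part is approximated by `j
    -- u`, and `j u` by `(l Q l)² (j u)`.
    set K := j.range.topologicalClosure
    have : CompleteSpace K := j.range.isClosed_topologicalClosure.completeSpace_coe
    obtain ⟨y, hy, z, hz, rfl⟩ := K.exists_add_mem_mem_orthogonal x
    have hz' : Q 1 z = 0 := by
      refine (formResolvent_eq_zero_iff hj hα hL one_pos).2 (ext_inner_left ℂ fun v => ?_)
      rw [ContinuousLinearMap.adjoint_inner_right, inner_zero_right]
      exact hz (j v) (j.range.le_topologicalClosure ⟨v, rfl⟩)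
    obtain ⟨_, ⟨u, rfl⟩, hu⟩ := Metric.mem_closure_iff.1 hy (ε / 2) (by positivity)
    have hlim : Tendsto (fun l : ℝ => ‖L u‖ ^ 2 / α * l⁻¹) atTop (𝓝 0) := by
      simpa using (tendsto_inv_atTop_zero (𝕜 := ℝ)).const_mul (‖L u‖ ^ 2 / α)
    obtain ⟨l, hl, hl0⟩ := ((hlim.eventually (gt_mem_nhds
      (show 0 < (ε / 4) ^ 2 by positivity))).and (eventually_gt_atTop 0)).exists
    have h1 := (norm_smul_formResolvent_sub_le (j := j) hα hL hl0 u).trans_lt hl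
    have h2 : ‖l • Q l (j u) - j u‖ < ε / 4 := lt_of_pow_lt_pow_left₀ 2 (by positivity) h1
    have h3 : ‖l • Q l (l • Q l (j u) - j u)‖ ≤ ‖l • Q l (j u) - j u‖ := by
      rw [norm_smul, Real.norm_of_nonneg hl0.le]
      calc _ ≤ l * (l⁻¹ * ‖l • Q l (j u) - j u‖) := by
            gcongr; exact norm_formResolvent_le hα hL hl0 _
        _ = _ := by field_simp
    -- Since `Q l = Q 1 (1 + (1 - l) Q l)`, applying this factor twice moves the range of `(Q l)²`
    -- into that of `(Q 1)²`.
    obtain ⟨h, hh⟩ : ∃ h, l • Q l (l • Q l (j u)) = Q 1 (Q 1 h) := by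
      set y₁ := j u + (1 - l) • Q l (j u)
      refine ⟨(l * l) • (y₁ + (1 - l) • Q l y₁), ?_⟩
      have e1 : Q l (Q l (j u)) = Q 1 (Q l y₁) := by
        rw [hQ1 l hl0 (Q l (j u))]
        simp only [y₁, map_add, ContinuousLinearMap.map_smul_of_tower]
      rw [ContinuousLinearMap.map_smul_of_tower, ContinuousLinearMap.map_smul_of_tower,
        ContinuousLinearMap.map_smul_of_tower, e1]
      rw [smul_smul]
      congr 2
      exact hQ1 l hl0 y₁
    refine ⟨Q 1 (Q 1 h) + z, ?_, h, z, hz', rfl⟩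
    rw [Metric.mem_ball, dist_eq_norm, add_sub_add_right_eq_sub, ← hh]
    have hdec : l • Q l (l • Q l (j u)) - y = l • Q l (l • Q l (j u) - j u) +
        (l • Q l (j u) - j u) + (j u - y) := by
      rw [map_sub, smul_sub]; abel
    rw [hdec]
    have n1 := norm_add₃_le (a := l • Q l (l • Q l (j u) - j u)) (b := l • Q l (j u) - j u)
      (c := j u - y)
    rw [dist_comm, dist_eq_norm] at hu
    change ‖j u - y‖ < _ at hu
    linarith

end FormResolvent

/-! ### Semigroups generated by forms, and Galerkin approximation. -/

section FormSemigroup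

open ContinuousLinearMap (adjoint)

variable {V : Type*} [NormedAddCommGroup V] [InnerProductSpace ℂ V] [CompleteSpace V]
variable {H : Type*} [NormedAddCommGroup H] [InnerProductSpace ℂ H] [CompleteSpace H]
variable {j : V →L[ℂ] H} {L : V →L[ℂ] V} {α w : ℝ}

theorem hasBoundedInverse_shiftedGraph (hα : 0 < α)
    (hL : ∀ u, α * ‖u‖ ^ 2 ≤ (inner ℂ u (L u)).re) {a : V →ₗ[ℂ] V →ₗ⋆[ℂ] ℂ}
    (ha : ∀ u v, a u v = inner ℂ v (L u) - w * inner ℂ (j v) (j u)) {l : ℝ} (hl : w < l) :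
    HasBoundedInverse (shiftedGraph (l : ℂ) (associatedGraph (j : V →ₗ[ℂ] H) a))
      (formResolvent j L (l - w)) := by
  have hl' : 0 < l - w := sub_pos.2 hl
  have key : ∀ u f, (∀ v, a u v = inner ℂ (j v) (f - (l : ℂ) • j u)) ↔
      shiftedOperator j L (l - w) u = adjoint j f := by
    intro u f
    refine Iff.trans (forall_congr' fun v => ?_) (ext_iff_inner_left ℂ).symm
    rw [ha, shiftedOperator_apply, inner_add_right, inner_smul_right, inner_sub_right,
      inner_smul_right, ContinuousLinearMap.adjoint_inner_right,
      ContinuousLinearMap.adjoint_inner_right]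
    push_cast
    constructor <;> intro h <;> linear_combination h
  intro x f
  constructor
  · rintro ⟨x', y, ⟨u, hu, hy⟩, heq⟩
    obtain ⟨rfl, rfl⟩ := Prod.mk.inj heq
    obtain rfl : j u = x := hu
    rw [formResolvent_apply, ← eq_formSolution hα hL hl' ((key u _).1 fun v => by
      rw [add_sub_cancel_left]; exact hy v)]
  · rintro rfl
    exact ⟨_, f - (l : ℂ) • formResolvent j L (l - w) f, ⟨formSolution j L (l - w) f, rfl,
      (key _ _).2 (shiftedOperator_formSolution hα hL hl' f)⟩,
      Prod.ext rfl (add_sub_cancel _ _).symm⟩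

theorem isSemigroupGeneratedByNeg_associatedGraph (hj : Function.Injective j) (hα : 0 < α)
    (hL : ∀ u, α * ‖u‖ ^ 2 ≤ (inner ℂ u (L u)).re) {a : V →ₗ[ℂ] V →ₗ⋆[ℂ] ℂ}
    (ha : ∀ u v, a u v = inner ℂ v (L u) - w * inner ℂ (j v) (j u)) {T : ℝ → H →L[ℂ] H}
    (hT : IsYosidaLimit (formResolvent j L) T) :
    IsSemigroupGeneratedByNeg (associatedGraph (j : V →ₗ[ℂ] H) a)
      fun t => Real.exp (w * t) • T t := by
  have hQ := isContractivePseudoresolvent_formResolvent hj hα hL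
  refine ⟨hT.isDegenerateSemigroup_exp_smul hQ w, w, fun l hl =>
    ⟨_, hasBoundedInverse_shiftedGraph hα hL ha hl, fun x => ?_⟩⟩
  have hl' : 0 < l - w := sub_pos.2 hl
  have he : (fun t : ℝ => Real.exp (-(l * t)) • (Real.exp (w * t) • T t) x) =
      fun t => Real.exp (-((l - w) * t)) • T t x := by
    ext t
    rw [smul_apply, smul_smul, ← Real.exp_add]
    congr 2
    ring
  rw [he]
  exact ⟨hT.integrableOn hQ hl' x, hT.integral_eq hQ hl' x⟩

/-- The compression of an operator to a subspace. -/
noncomputable def compression (L : V →L[ℂ] V) (W : Submodule ℂ V) [CompleteSpace W] :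
    W →L[ℂ] W :=
  adjoint W.subtypeL ∘L L ∘L W.subtypeL

theorem inner_compression (W : Submodule ℂ V) [CompleteSpace W] (u v : W) :
    inner ℂ v (compression L W u) = inner ℂ (v : V) (L u) := by
  rw [compression, ContinuousLinearMap.comp_apply, ContinuousLinearMap.adjoint_inner_right]
  rfl

theorem adjoint_comp_subtypeL_apply (W : Submodule ℂ V) [CompleteSpace W] (f : H) :
    adjoint (j ∘L W.subtypeL) f = adjoint W.subtypeL (adjoint j f) := by
  rw [ContinuousLinearMap.adjoint_comp]
  rfl

/-- Céa's lemma: the error `e` satisfies `(M e, v) = 0` for `v ∈ W`, so in `(M e, e)` the second `e`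
may be replaced by `z - u`. -/
theorem norm_formSolution_compression_sub_le (hα : 0 < α)
    (hL : ∀ u, α * ‖u‖ ^ 2 ≤ (inner ℂ u (L u)).re) {l : ℝ} (hl : 0 < l) (W : Submodule ℂ V)
    [CompleteSpace W] (f : H) (z : W) :
    α * ‖(formSolution (j ∘L W.subtypeL) (compression L W) l f : V) - formSolution j L l f‖ ≤
      ‖shiftedOperator j L l‖ * ‖(z : V) - formSolution j L l f‖ := by
  have hLW : ∀ u : W, α * ‖u‖ ^ 2 ≤ (inner ℂ u (compression L W u)).re := fun u => by
    rw [inner_compression]; exact hL u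
  set y := formSolution (j ∘L W.subtypeL) (compression L W) l f
  set u := formSolution j L l f
  set M := shiftedOperator j L l
  have horth : ∀ v : W, inner ℂ (v : V) (M (y - u)) = 0 := by
    intro v
    have h1 := shiftedOperator_formSolution (j := j) hα hL hl f
    have h2 := congrArg (inner ℂ v)
      (shiftedOperator_formSolution (j := j ∘L W.subtypeL) hα hLW hl f)
    rw [shiftedOperator_apply, inner_add_right, inner_smul_right, inner_compression,
      ContinuousLinearMap.adjoint_inner_right, ContinuousLinearMap.adjoint_inner_right] at h2
    rw [map_sub, h1, inner_sub_right, shiftedOperator_apply, inner_add_right, inner_smul_right,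
      ContinuousLinearMap.adjoint_inner_right, ContinuousLinearMap.adjoint_inner_right]
    exact sub_eq_zero.2 h2
  set e := (y : V) - u
  have h1 : α * ‖e‖ ^ 2 ≤ (inner ℂ e (M e)).re := coercive_shiftedOperator hL hl e
  have h2 : inner ℂ e (M e) = inner ℂ ((z : V) - u) (M e) := by
    have h3 : e = ((y - z : W) : V) + (z - u) := by simp [e]
    conv_lhs => rw [h3, inner_add_left, ← h3, horth, zero_add]
  have h4 : (inner ℂ ((z : V) - u) (M e)).re ≤ ‖(z : V) - u‖ * ‖M e‖ :=
    re_inner_le_norm (𝕜 := ℂ) _ _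
  have h5 := M.le_opNorm e
  rw [h2] at h1
  rcases eq_or_ne e 0 with h0 | h0
  · rw [h0, norm_zero, mul_zero]; positivity
  · refine le_of_mul_le_mul_right ?_ (norm_pos_iff.2 h0)
    calc α * ‖e‖ * ‖e‖ = α * ‖e‖ ^ 2 := by ring
      _ ≤ ‖(z : V) - u‖ * (‖M‖ * ‖e‖) := h1.trans (h4.trans (by gcongr))
      _ = _ := by ring

theorem tendsto_formResolvent_compression (hα : 0 < α)
    (hL : ∀ u, α * ‖u‖ ^ 2 ≤ (inner ℂ u (L u)).re) {W : ℕ → Submodule ℂ V}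
    [∀ n, CompleteSpace (W n)] (hmono : Monotone W) (hdense : Dense (⋃ n, (W n : Set V)))
    {l : ℝ} (hl : 0 < l) (f : H) :
    Tendsto (fun n => formResolvent (j ∘L (W n).subtypeL) (compression L (W n)) l f) atTop
      (𝓝 (formResolvent j L l f)) := by
  refine (j.continuous.tendsto (formSolution j L l f)).comp
    (f := fun n => (formSolution (j ∘L (W n).subtypeL) (compression L (W n)) l f : V)) ?_
  rw [Metric.tendsto_atTop]
  intro ε hε
  set u := formSolution j L l f
  set M := ‖shiftedOperator j L l‖
  have hM : 0 ≤ M := norm_nonneg _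
  obtain ⟨z, hzu, hz⟩ := Metric.dense_iff.1 hdense u (α * ε / (M + 1)) (by positivity)
  obtain ⟨N, hN⟩ := Set.mem_iUnion.1 hz
  rw [Metric.mem_ball, dist_eq_norm] at hzu
  refine ⟨N, fun n hn => ?_⟩
  have h1 := norm_formSolution_compression_sub_le (j := j) hα hL hl (W n) f ⟨z, hmono hn hN⟩
  rw [dist_eq_norm]
  refine lt_of_mul_lt_mul_left (h1.trans_lt ?_) hα.le
  rw [lt_div_iff₀ (by positivity)] at hzu
  change M * ‖z - u‖ < _
  rcases eq_or_ne (z - u) 0 with h0 | h0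
  · rw [h0, norm_zero, mul_zero]; positivity
  · have := norm_pos_iff.2 h0
    linarith

end FormSemigroup

/-! ### The convergence theorem. -/

theorem theorem3p7
    {V : Type*} [NormedAddCommGroup V] [InnerProductSpace ℂ V] [CompleteSpace V]
    {H : Type*} [NormedAddCommGroup H] [InnerProductSpace ℂ H] [CompleteSpace H]
    (j : V →L[ℂ] H) (hj : Function.Injective j)
    (a : V →ₗ[ℂ] V →ₗ⋆[ℂ] ℂ)
    (ha_sectorial : IsSectorialForm (j : V →ₗ[ℂ] H) a)
    (ha_closed : IsClosedForm (j : V →ₗ[ℂ] H) a)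
    (Vn : ℕ → Submodule ℂ V) (hVn_mono : Monotone Vn)
    (hVn_closed : ∀ n, IsClosed (Vn n : Set V))
    (hVn_dense : Dense (⋃ n, (Vn n : Set V)))
    (A : Submodule ℂ (H × H)) (hA : A = associatedGraph (j : V →ₗ[ℂ] H) a)
    (An : ℕ → Submodule ℂ (H × H))
    (hAn : ∀ n, An n =
      associatedGraph ((j : V →ₗ[ℂ] H).comp (Vn n).subtype) (restrictForm a (Vn n))) :
    -- the semigroups exist
    (∃ S : ℝ → H →L[ℂ] H, IsSemigroupGeneratedByNeg A S) ∧
    (∀ n, ∃ S : ℝ → H →L[ℂ] H, IsSemigroupGeneratedByNeg (An n) S) ∧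
    -- and they converge strongly, uniformly on bounded time intervals
    (∀ (S : ℝ → H →L[ℂ] H) (Sn : ℕ → ℝ → H →L[ℂ] H),
      IsSemigroupGeneratedByNeg A S →
      (∀ n, IsSemigroupGeneratedByNeg (An n) (Sn n)) →
      ∀ T : ℝ, 0 < T → ∀ f : H,
        Tendsto (fun n => ⨆ t ∈ Set.Ioc 0 T, ‖(Sn n t - S t) f‖ₑ) atTop (𝓝 0)) := by
  obtain ⟨w, α, M, hα, hcoer, hbound⟩ := ha_closed.exists_bounds hj
  obtain ⟨L₀, hL₀⟩ := exists_inner_eq_sesquilin hbound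
  have hcomplete : ∀ n, CompleteSpace (Vn n) := fun n => (hVn_closed n).completeSpace_coe
  -- The shift by `w` is absorbed into the operator, and one `α` then serves for all compressions.
  set L := shiftedOperator j L₀ w
  have ha : ∀ u v, a u v = inner ℂ v (L u) - w * inner ℂ (j v) (j u) := fun u v => by
    rw [shiftedOperator_apply, inner_add_right, inner_smul_right,
      ContinuousLinearMap.adjoint_inner_right, hL₀, add_sub_cancel_right]
  have hL : ∀ u, α * ‖u‖ ^ 2 ≤ (inner ℂ u (L u)).re := fun u => by
    rw [re_inner_shiftedOperator, ← hL₀]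
    exact hcoer u
  have hLn : ∀ n (u : Vn n), α * ‖u‖ ^ 2 ≤ (inner ℂ u (compression L (Vn n) u)).re := fun n u => by
    rw [inner_compression]; exact hL u
  have hjn : ∀ n, Function.Injective (j ∘L (Vn n).subtypeL) := fun n =>
    hj.comp Subtype.val_injective
  have hQ := isContractivePseudoresolvent_formResolvent hj hα hL
  have hQn := fun n => isContractivePseudoresolvent_formResolvent (hjn n) hα (hLn n)
  obtain ⟨U, hU⟩ := hQ.exists_isYosidaLimit
  choose Un hUn using fun n => (hQn n).exists_isYosidaLimit
  have hgen : IsSemigroupGeneratedByNeg A fun t => Real.exp (w * t) • U t := by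
    rw [hA]
    exact isSemigroupGeneratedByNeg_associatedGraph hj hα hL ha hU
  have hgenn : ∀ n, IsSemigroupGeneratedByNeg (An n) fun t => Real.exp (w * t) • Un n t := by
    intro n
    rw [hAn]
    refine isSemigroupGeneratedByNeg_associatedGraph (j := j ∘L (Vn n).subtypeL) (hjn n) hα (hLn n)
      (fun u v => ?_) (hUn n)
    rw [inner_compression]
    exact ha u v
  refine ⟨⟨_, hgen⟩, fun n => ⟨_, hgenn n⟩, fun S Sn hS hSn T hT f => ?_⟩
  have hker : ∀ x, formResolvent j L 1 x = 0 →
      ∀ n, formResolvent (j ∘L (Vn n).subtypeL) (compression L (Vn n)) 1 x = 0 := by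
    intro x hx n
    rw [formResolvent_eq_zero_iff (hjn n) hα (hLn n) one_pos, adjoint_comp_subtypeL_apply,
      (formResolvent_eq_zero_iff hj hα hL one_pos).1 hx, map_zero]
  rw [ENNReal.tendsto_nhds_zero]
  intro ε hε
  rcases eq_or_ne ε ⊤ with rfl | hε'
  · exact Eventually.of_forall fun _ => le_top
  have hε0 : 0 < ε.toReal := ENNReal.toReal_pos hε.ne' hε'
  filter_upwards [hU.eventually_norm_sub_le hQ hUn hQn
    (fun l hl x => tendsto_formResolvent_compression hα hL hVn_mono hVn_dense hl x) hker T f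
    (show 0 < ε.toReal / Real.exp (|w| * T) by positivity)] with n hn
  refine iSup₂_le fun t ht => ?_
  -- Uniqueness replaces the given semigroups by the constructed ones; the factor `e^{wt} ≤
  -- e^{|w|T}` was paid for in the choice of tolerance.
  rw [(hSn n).eqOn (hgenn n) ht.1, hS.eqOn hgen ht.1, ← smul_sub, smul_apply, sub_apply,
    ← ofReal_norm, norm_smul, Real.norm_of_nonneg (Real.exp_nonneg _)]
  refine ENNReal.ofReal_le_of_le_toReal ?_
  have h1 : w * t ≤ |w| * T :=
    mul_le_mul (le_abs_self w) ht.2 ht.1.le (abs_nonneg w)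
  calc _ ≤ Real.exp (|w| * T) * (ε.toReal / Real.exp (|w| * T)) := by
        gcongr
        exact hn t ht
    _ = ε.toReal := by field_simp
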